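/- **Setting.** A *surface* in affine space $A^3=\mathbb R^3$ is a smooth ($C^\infty$) embedded 2-dimensional submanifold. An affine frame $(e_1,e_2,e_3;p)$ at a point $p$ of a surface $S$ (a basis $e_1,e_2,e_3$ with origin $p$) gives affine coordinates $(x,y,z)\mapsto p+xe_1+ye_2+ze_3$. The frame is *adapted* at $p$ if in these coordinates $S$ is near $p$ the graph of a smooth function with $$z=\tfrac12(x^2+y^2)+\tfrac16(x^3-3xy^2)+\tfrac1{24}\left(I_{40}x^4+4I_{31}x^3y+6I_{22}x^2y^2+4I_{13}xy^3+I_{04}y^4\right)+o\!\left(|(x,y)|^4\right);$$ the numbers $I_{40},I_{31},I_{22},I_{13},I_{04}$ are the *curvatures* of $S$ at $p$ with respect to the frame. $S$ is *regular elliptical* if it has an adapted frame at each of its points. For a smooth field $e=(e_1,e_2,e_3)$ of adapted frames on an open part of $S$ (a *moving frame*), the *invariant coframe* $w_1,w_2$ consists of the 1-forms on that part of $S$ with $dr=w_1e_1+w_2e_2$, where $r$ is the position vector. **Theorem 4.2.** Let $S\subset A^3$ be a regular elliptical surface. Then: 1. Near every point of $S$ there is a moving frame. If $e$ is an adapted frame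 at $p\in S$, then a frame $e'$ at $p$ is adapted if and only if it is obtained from $e$ by an element of the dihedral group $D_3$ of order $6$, i.e. $e_1'=ce_1+se_2$, $e_2'=\pm(-se_1+ce_2)$, $e_3'=e_3$ with $(c,s)\in\{(1,0),(-\frac12,\frac{\sqrt3}2),(-\frac12,-\frac{\sqrt3}2)\}$. 2. For every moving frame, $w_1,w_2$ are well defined and linearly independent at each point, and $$dw_1=\tfrac23I_{13}\,w_1\wedge w_2,\qquad dw_2=\left(\tfrac14I_{40}-\tfrac12I_{22}-\tfrac1{12}I_{04}\right)w_1\wedge w_2 .$$ Hence, if $dw_1=Y_1\,w_1\wedge w_2$ and $dw_2=Y_2\,w_1\wedge w_2$, then $I_{13}=\frac32Y_1$ and $I_{04}=3I_{40}-6I_{22}-12Y_2$. 3. (Invariance.) For every affine transformation $T$ of $A^3$, $T(S)$ is regular elliptical, $T$ maps each moving frame of $S$ to a moving frame of $T(S)$, and the corresponding coframes and curvatures agree under $T$. 4. (Completeness.) Let $S$ be connected and let $S'$ be a regular elliptical surface. Say that a smooth map $\varphi:S\to S'$ *preserves the invariants* if near every $p\in S$ and near $\varphi(p)\in S'$ there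 are moving frames whose coframes and curvatures satisfy $\varphi^*w_1'=w_1$, $\varphi^*w_2'=w_2$, $I_{40}'\circ\varphi=I_{40}$, $I_{31}'\circ\varphi=I_{31}$, $I_{22}'\circ\varphi=I_{22}$. Every $\varphi$ that preserves the invariants is the restriction to $S$ of an affine transformation of $A^3$. In particular, $T(S)=S'$ for some affine transformation $T$ if and only if there is a smooth bijection $S\to S'$ that preserves the invariants. -/

import Mathlib

open Set Filter Topology Asymptotics
open scoped ContDiff

namespace GenAffine

/-- The affine space `A³` with its affine coordinates `x, y, z`. -/
abbrev A3 : Type := Fin 3 → ℝ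

/-- The parameter plane. -/
abbrev Plane : Type := ℝ × ℝ

/-- An affine frame `(e₁, e₂, e₃; p)` is the affine transformation
`ξ ↦ p + ξ₁ e₁ + ξ₂ e₂ + ξ₃ e₃`. The predicate says that, in the affine coordinates `ξ` given by
the frame, the set `S` is near the origin `p` the graph `ξ₃ = f (ξ₁, ξ₂)` of a smooth function. -/
def IsLocalGraph (S : Set A3) (p : A3) (e : Fin 3 → A3) (f : Plane → ℝ) : Prop :=
  LinearIndependent ℝ e ∧
  ∃ ε : ℝ, 0 < ε ∧ ContDiffOn ℝ ∞ f (Metric.ball 0 ε) ∧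
    ∀ ξ : Fin 3 → ℝ, ‖ξ‖ < ε → (p + ∑ i, ξ i • e i ∈ S ↔ ξ 2 = f (ξ 0, ξ 1))

/-- `½ (x² + y²) + ⅙ (x³ - 3 x y²)`, the standard form of a regular elliptical jet of order 3. -/
noncomputable def standardCubic (s : Plane) : ℝ :=
  (s.1 ^ 2 + s.2 ^ 2) / 2 + (s.1 ^ 3 - 3 * s.1 * s.2 ^ 2) / 6

/-- Values of the five curvatures `I₄₀, I₃₁, I₂₂, I₁₃, I₀₄`. -/
structure Curvatures where
  i40 : ℝ
  i31 : ℝ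
  i22 : ℝ
  i13 : ℝ
  i04 : ℝ

/-- The fourth-order Taylor term `(1/4!) ∑_{i+j=4} (4 choose i) I_{ij} xⁱ yʲ`. -/
noncomputable def quarticTerm (I : Curvatures) (s : Plane) : ℝ :=
  (I.i40 * s.1 ^ 4 + 4 * I.i31 * s.1 ^ 3 * s.2 + 6 * I.i22 * s.1 ^ 2 * s.2 ^ 2
    + 4 * I.i13 * s.1 * s.2 ^ 3 + I.i04 * s.2 ^ 4) / 24

/-- The frame `(e; p)` brings the 3-jet of `S` at `p` to the regular elliptical standard form. -/
def IsAdaptedFrame (S : Set A3) (p : A3) (e : Fin 3 → A3) : Prop :=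
  ∃ f : Plane → ℝ, IsLocalGraph S p e f ∧
    (fun s : Plane => f s - standardCubic s) =o[𝓝 0] (fun s : Plane => ‖s‖ ^ 3)

/-- The frame `(e; p)` brings the 3-jet of `S` at `p` to the regular elliptical standard form, and
the fourth-order Taylor coefficients of `S` in this frame are the curvatures `I`. -/
def HasCurvatures (S : Set A3) (p : A3) (e : Fin 3 → A3) (I : Curvatures) : Prop :=
  ∃ f : Plane → ℝ, IsLocalGraph S p e f ∧
    (fun s : Plane => f s - (standardCubic s + quarticTerm I s)) =o[𝓝 0]
      (fun s : Plane => ‖s‖ ^ 4)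

/-- A regular elliptical surface: a smooth embedded surface whose jet at each of its points can be
brought to the regular elliptical standard form by an affine transformation. -/
def IsRegularElliptical (S : Set A3) : Prop :=
  ∀ p ∈ S, ∃ e : Fin 3 → A3, IsAdaptedFrame S p e

/-- `e` is a smooth adapted moving frame on the open part `S ∩ N` of the surface `S`, and the
functions `I` are the curvatures of `S` with respect to it. -/
structure IsMovingFrame (S N : Set A3) (e : A3 → Fin 3 → A3) (I : A3 → Curvatures) : Prop where
  isOpen : IsOpen N
  smooth : ContDiffOn ℝ ∞ e (S ∩ N)
  adapted : ∀ p ∈ S ∩ N, HasCurvatures S p (e p) (I p)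

/-- `e'` is obtained from the frame `e` by an element of the symmetry group `D₃` of the triangle
with vertices `(1, 0)`, `(-1/2, √3/2)`, `(-1/2, -√3/2)`: `(c, s)` is the image of `(1, 0)` and
`δ` is the determinant. -/
def IsD3Related (e e' : Fin 3 → A3) : Prop :=
  ∃ c s δ : ℝ,
    ((c = 1 ∧ s = 0) ∨ (c = -1 / 2 ∧ s = √3 / 2) ∨ (c = -1 / 2 ∧ s = -√3 / 2)) ∧
    (δ = 1 ∨ δ = -1) ∧
    e' 0 = c • e 0 + s • e 1 ∧ e' 1 = δ • ((-s) • e 0 + c • e 1) ∧ e' 2 = e 2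

/-- The `i`-th coordinate of a vector `v` with respect to the frame `e`, as a linear form in `v`. -/
noncomputable def coordForm (e : Fin 3 → A3) (i : Fin 3) : A3 →L[ℝ] ℝ :=
  LinearMap.toContinuousLinearMap
    ((LinearMap.proj i).comp (Matrix.mulVecLin ((Matrix.of e).transpose)⁻¹))

/-- A smooth immersion `X` of an open subset `U` of the plane with values in `S`. -/
structure IsPatch (S : Set A3) (U : Set Plane) (X : Plane → A3) : Prop where
  isOpen : IsOpen U
  smooth : ContDiffOn ℝ ∞ X U
  mapsTo : MapsTo X U S
  immersion : ∀ u ∈ U, Function.Injective (fderiv ℝ X u)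

/-- The 1-forms dual to the moving frame `e`, pulled back by `X`: the forms `w_i` with
`dX = ∑ w_i e_i`. The invariant coframe `w₁, w₂` is given by the indices `0` and `1`. -/
noncomputable def coframe (e : A3 → Fin 3 → A3) (X : Plane → A3) (i : Fin 3) (u : Plane) :
    Plane →L[ℝ] ℝ :=
  (coordForm (e (X u)) i).comp (fderiv ℝ X u)

/-- A 1-form on the plane as a field of alternating maps. -/
noncomputable def oneForm (w : Plane → Plane →L[ℝ] ℝ) (u : Plane) : Plane [⋀^Fin 1]→L[ℝ] ℝ :=
  ContinuousAlternatingMap.ofSubsingleton ℝ Plane ℝ (0 : Fin 1) (w u)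

/-- `dw = Y w₁ ∧ w₂` at the point `u`. -/
def ExtDerivEq (w w₁ w₂ : Plane → Plane →L[ℝ] ℝ) (u : Plane) (Y : ℝ) : Prop :=
  ∀ a b : Plane,
    extDeriv (oneForm w) u ![a, b] = Y * (w₁ u a * w₂ u b - w₁ u b * w₂ u a)

/-- The smooth map `φ : S → S'` preserves the coframe `w₁, w₂` and the curvatures
`I₄₀, I₃₁, I₂₂`: near every point of `S` there are smooth adapted moving frames of `S` and of `S'`
such that `φ` pulls the coframe and these three curvatures of `S'` back to those of `S`. -/
def PreservesInvariants (S S' : Set A3) (φ : A3 → A3) : Prop :=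
  ContDiffOn ℝ ∞ φ S ∧ MapsTo φ S S' ∧
  ∀ p ∈ S, ∃ (N N' : Set A3) (e e' : A3 → Fin 3 → A3) (I I' : A3 → Curvatures),
    p ∈ N ∧ MapsTo φ (S ∩ N) N' ∧ IsMovingFrame S N e I ∧ IsMovingFrame S' N' e' I' ∧
    (∀ q ∈ S ∩ N, (I' (φ q)).i40 = (I q).i40 ∧ (I' (φ q)).i31 = (I q).i31 ∧
      (I' (φ q)).i22 = (I q).i22) ∧
    ∀ (U : Set Plane) (X : Plane → A3), IsPatch (S ∩ N) U X → ∀ u ∈ U,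
      coframe e' (φ ∘ X) 0 u = coframe e X 0 u ∧ coframe e' (φ ∘ X) 1 u = coframe e X 1 u

end GenAffine

/-! Near a point, `S` is a graph z = f(x, y). Inserting a frame `m` into z - f(x, y) and comparing
the terms of order 1, 2 and 3 with the standard form turns adaptedness into nine algebraic
equations, `FrameEqs`, in the 3-jet of f and the nine entries of `m`. The whole theorem rests on
this system.

Uniqueness: relative to one solution, the tangential part of another is a similarity, that is,
multiplication by a complex number, possibly after conjugation. Since the cubic is Re (x + iy)³,
which is harmonic, the third vector cannot change and the complex number must be a cube root of
unity (`d3_of_equations`).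

Existence: `frameSol` solves the system explicitly. Gram-Schmidt diagonalizes the Hessian, a
rotation and a dilation normalize the apolar part of the cubic form, and the tangential part of the
third vector removes its trace part. The formula is smooth in the jet, which gives moving frames.

Structure equations: differentiated at an adapted frame, the nine equations become a linear system
for the nine entries of the derivative of the frame. Its only solution `conn` involves just the
coframe and the five curvatures (`structure_equations`). Symmetry of the second derivative of the
position vector then yields dw₁ and dw₂, hence I₁₃ and I₀₄.

Completeness: equal coframes and equal I₄₀, I₃₁, I₂₂ therefore give five equal curvatures, so both
frames satisfy the same linear differential equations. The linear map carrying one frame to the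
other is then constant, and the surfaces correspond locally under an affine map. A piece of a curved
surface determines an affine map, so the local maps glue on a connected surface. -/

namespace GenAffine

/-! ### Partial derivatives and Taylor's theorem in the plane. -/

/-- The partial derivative in the first variable. -/
noncomputable def pd1 (g : Plane → ℝ) (u : Plane) : ℝ := fderiv ℝ g u (1, 0)

/-- The partial derivative in the second variable. -/
noncomputable def pd2 (g : Plane → ℝ) (u : Plane) : ℝ := fderiv ℝ g u (0, 1)

/-- The mixed partial derivative of order `(i, j)`. -/
noncomputable def jet (g : Plane → ℝ) (u : Plane) (i j : ℕ) : ℝ := (pd1^[i] (pd2^[j] g)) u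

theorem fderiv_eq_pd (g : Plane → ℝ) (u v : Plane) :
    fderiv ℝ g u v = v.1 * pd1 g u + v.2 * pd2 g u := by
  have : v = v.1 • ((1, 0) : Plane) + v.2 • ((0, 1) : Plane) := by ext <;> simp
  conv_lhs => rw [this]
  rw [map_add, map_smul, map_smul]
  rfl

theorem contDiffAt_pd1 {g : Plane → ℝ} {u : Plane} (hg : ContDiffAt ℝ ∞ g u) :
    ContDiffAt ℝ ∞ (pd1 g) u :=
  (hg.fderiv_right (m := ∞) (by simp)).clm_apply contDiffAt_const

theorem contDiffAt_pd2 {g : Plane → ℝ} {u : Plane} (hg : ContDiffAt ℝ ∞ g u) :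
    ContDiffAt ℝ ∞ (pd2 g) u :=
  (hg.fderiv_right (m := ∞) (by simp)).clm_apply contDiffAt_const

theorem contDiffAt_jet {g : Plane → ℝ} {u : Plane} (hg : ContDiffAt ℝ ∞ g u) (i j : ℕ) :
    ContDiffAt ℝ ∞ (fun s => jet g s i j) u := by
  have h2 : ∀ j, ContDiffAt ℝ ∞ (pd2^[j] g) u := by
    intro j
    induction j with
    | zero => exact hg
    | succ j ih => rw [Function.iterate_succ_apply']; exact contDiffAt_pd2 ih
  change ContDiffAt ℝ ∞ (pd1^[i] (pd2^[j] g)) u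
  induction i with
  | zero => exact h2 j
  | succ i ih => rw [Function.iterate_succ_apply']; exact contDiffAt_pd1 ih

theorem eventuallyEq_pd1 {g h : Plane → ℝ} {u : Plane} (e : g =ᶠ[𝓝 u] h) :
    pd1 g =ᶠ[𝓝 u] pd1 h := by
  filter_upwards [e.fderiv (𝕜 := ℝ)] with s hs
  simp [pd1, hs]

theorem eventuallyEq_pd2 {g h : Plane → ℝ} {u : Plane} (e : g =ᶠ[𝓝 u] h) :
    pd2 g =ᶠ[𝓝 u] pd2 h := by
  filter_upwards [e.fderiv (𝕜 := ℝ)] with s hs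
  simp [pd2, hs]

theorem pd_comm {g : Plane → ℝ} {u : Plane} (hg : ContDiffAt ℝ 2 g u) :
    pd1 (pd2 g) u = pd2 (pd1 g) u := by
  have hs : IsSymmSndFDerivAt ℝ g u := hg.isSymmSndFDerivAt (by simp)
  have hd : DifferentiableAt ℝ (fderiv ℝ g) u :=
    (hg.fderiv_right (m := 1) (by norm_num)).differentiableAt (by norm_num)
  have h : ∀ a b : Plane, fderiv ℝ (fun s => fderiv ℝ g s a) u b
      = fderiv ℝ (fderiv ℝ g) u b a := by
    intro a b
    rw [fderiv_clm_apply hd (by fun_prop)]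
    simp
  change fderiv ℝ (fun s => fderiv ℝ g s (0, 1)) u (1, 0)
    = fderiv ℝ (fun s => fderiv ℝ g s (1, 0)) u (0, 1)
  rw [h, h]
  exact hs _ _

theorem eventually_pd_comm {g : Plane → ℝ} {u : Plane} (hg : ContDiffAt ℝ ∞ g u) :
    ∀ᶠ s in 𝓝 u, pd1 (pd2 g) s = pd2 (pd1 g) s := by
  have h2 : ContDiffAt ℝ 2 g u := hg.of_le (WithTop.coe_le_coe.2 le_top)
  filter_upwards [h2.eventually (by simp)] with s hs using pd_comm hs

/-- Partial derivatives commute at every point near `u`. The identities are carried as eventual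
equalities because only these survive further differentiation. -/
theorem jet_pd1 {g : Plane → ℝ} {u : Plane} (hg : ContDiffAt ℝ ∞ g u) (i j : ℕ) :
    jet (pd1 g) u i j = jet g u (i + 1) j := by
  have key : ∀ j, pd2^[j] (pd1 g) =ᶠ[𝓝 u] pd1 (pd2^[j] g) := by
    intro j
    induction j with
    | zero => rfl
    | succ j ih =>
      rw [Function.iterate_succ_apply', Function.iterate_succ_apply']
      refine (eventuallyEq_pd2 ih).trans ?_
      filter_upwards [eventually_pd_comm (contDiffAt_jet hg 0 j)] with s hs
      exact hs.symm
  have key2 : ∀ i, pd1^[i] (pd2^[j] (pd1 g)) =ᶠ[𝓝 u] pd1^[i] (pd1 (pd2^[j] g)) := by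
    intro i
    induction i with
    | zero => exact key j
    | succ i ih =>
      rw [Function.iterate_succ_apply', Function.iterate_succ_apply']
      exact eventuallyEq_pd1 ih
  exact (key2 i).self_of_nhds

theorem pd1_jet (g : Plane → ℝ) (u : Plane) (i j : ℕ) :
    pd1 (fun s => jet g s i j) u = jet g u (i + 1) j := by
  simp only [jet, Function.iterate_succ_apply']

theorem pd2_jet {g : Plane → ℝ} {u : Plane} (hg : ContDiffAt ℝ ∞ g u) (i j : ℕ) :
    pd2 (fun s => jet g s i j) u = jet g u i (j + 1) := by
  have key : ∀ i, pd2 (pd1^[i] (pd2^[j] g)) =ᶠ[𝓝 u] pd1^[i] (pd2 (pd2^[j] g)) := by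
    intro i
    induction i with
    | zero => rfl
    | succ i ih =>
      rw [Function.iterate_succ_apply', Function.iterate_succ_apply']
      refine EventuallyEq.trans ?_ (eventuallyEq_pd1 ih)
      filter_upwards [eventually_pd_comm (contDiffAt_jet hg i j)] with s hs
      exact hs.symm
  have := (key i).self_of_nhds
  rwa [← Function.iterate_succ_apply' pd2] at this

/-- If the derivative of `r` is `o(|s|ⁿ)` and `r 0 = 0`, then `r` is `o(|s|ⁿ⁺¹)`. -/
theorem isLittleO_succ {r : Plane → ℝ} {n : ℕ} (hr : ∀ᶠ s in 𝓝 0, DifferentiableAt ℝ r s)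
    (h0 : r 0 = 0) (h1 : pd1 r =o[𝓝 0] fun s : Plane => ‖s‖ ^ n)
    (h2 : pd2 r =o[𝓝 0] fun s : Plane => ‖s‖ ^ n) :
    r =o[𝓝 0] fun s : Plane => ‖s‖ ^ (n + 1) := by
  rw [isLittleO_iff]
  intro c hc
  have hc2 : 0 < c / 2 := by positivity
  obtain ⟨δ, hδ, H⟩ := Metric.eventually_nhds_iff_ball.1
    ((hr.and (isLittleO_iff.1 h1 hc2)).and (isLittleO_iff.1 h2 hc2))
  filter_upwards [Metric.ball_mem_nhds (0 : Plane) hδ] with s hs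
  have hsub : Metric.closedBall (0 : Plane) ‖s‖ ⊆ Metric.ball 0 δ :=
    Metric.closedBall_subset_ball (by simpa using hs)
  -- Each partial derivative contributes `c / 2`, so the operator norm is at most `c * ‖s‖ ^ n` on
  -- the whole ball of radius `‖s‖`; the mean value inequality from 0 to `s` supplies the extra
  -- factor `‖s‖`.
  have bound : ∀ x ∈ Metric.closedBall (0 : Plane) ‖s‖, ‖fderiv ℝ r x‖ ≤ c * ‖s‖ ^ n := by
    intro x hx
    obtain ⟨⟨_, hb1⟩, hb2⟩ := H x (hsub hx)
    have hx' : ‖x‖ ^ n ≤ ‖s‖ ^ n := by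
      have : ‖x‖ ≤ ‖s‖ := by simpa using hx
      gcongr
    refine ContinuousLinearMap.opNorm_le_bound _ (by positivity) fun v => ?_
    rw [fderiv_eq_pd]
    have e1 := norm_fst_le v
    have e2 := norm_snd_le v
    have e3 : ‖‖x‖ ^ n‖ = ‖x‖ ^ n := by simp
    rw [e3] at hb1 hb2
    calc ‖v.1 * pd1 r x + v.2 * pd2 r x‖ ≤ ‖v.1‖ * ‖pd1 r x‖ + ‖v.2‖ * ‖pd2 r x‖ := by
          refine (norm_add_le _ _).trans ?_
          rw [norm_mul, norm_mul]
      _ ≤ ‖v‖ * (c / 2 * ‖s‖ ^ n) + ‖v‖ * (c / 2 * ‖s‖ ^ n) := by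
          gcongr
          · exact hb1.trans (by gcongr)
          · exact hb2.trans (by gcongr)
      _ = c * ‖s‖ ^ n * ‖v‖ := by ring
  have := (convex_closedBall (0 : Plane) ‖s‖).norm_image_sub_le_of_norm_fderiv_le
    (fun x hx => (H x (hsub hx)).1.1) bound (x := 0) (y := s) (by simp) (by simp)
  rw [h0] at this
  simpa [pow_succ, mul_assoc] using this

/-- The homogeneous Taylor polynomial of degree `k` with the partial derivatives `J`. -/
noncomputable def taylorTerm (k : ℕ) (J : ℕ → ℕ → ℝ) (s : Plane) : ℝ :=
  ∑ p ∈ Finset.HasAntidiagonal.antidiagonal k,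
    J p.1 p.2 * ((p.1.factorial : ℝ)⁻¹ * s.1 ^ p.1 * ((p.2.factorial : ℝ)⁻¹ * s.2 ^ p.2))

theorem differentiable_taylorTerm (k : ℕ) (J : ℕ → ℕ → ℝ) :
    Differentiable ℝ (taylorTerm k J) := by
  unfold taylorTerm
  fun_prop

theorem hasFDerivAt_monomial (i j : ℕ) (s : Plane) :
    HasFDerivAt (fun s : Plane => (i.factorial : ℝ)⁻¹ * s.1 ^ i * ((j.factorial : ℝ)⁻¹ * s.2 ^ j))
      (((i.factorial : ℝ)⁻¹ * s.1 ^ i) • ((j.factorial : ℝ)⁻¹ • ((j • s.2 ^ (j - 1)) •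
          ContinuousLinearMap.snd ℝ ℝ ℝ))
        + ((j.factorial : ℝ)⁻¹ * s.2 ^ j) • ((i.factorial : ℝ)⁻¹ • ((i • s.1 ^ (i - 1)) •
          ContinuousLinearMap.fst ℝ ℝ ℝ))) s := by
  exact (((hasFDerivAt_fst (𝕜 := ℝ) (p := s)).pow i).const_mul _).mul
    (((hasFDerivAt_snd (𝕜 := ℝ) (p := s)).pow j).const_mul _)

theorem hasFDerivAt_taylorTerm (k : ℕ) (J : ℕ → ℕ → ℝ) (s : Plane) :
    HasFDerivAt (taylorTerm k J) (∑ p ∈ Finset.HasAntidiagonal.antidiagonal k, J p.1 p.2 •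
      (((p.1.factorial : ℝ)⁻¹ * s.1 ^ p.1) • ((p.2.factorial : ℝ)⁻¹ • ((p.2 • s.2 ^ (p.2 - 1)) •
          ContinuousLinearMap.snd ℝ ℝ ℝ))
        + ((p.2.factorial : ℝ)⁻¹ * s.2 ^ p.2) • ((p.1.factorial : ℝ)⁻¹ • ((p.1 • s.1 ^ (p.1 - 1)) •
          ContinuousLinearMap.fst ℝ ℝ ℝ)))) s := by
  unfold taylorTerm
  exact HasFDerivAt.fun_sum fun p _ => (hasFDerivAt_monomial p.1 p.2 s).const_mul _

theorem pd1_taylorTerm_succ (k : ℕ) (J : ℕ → ℕ → ℝ) (s : Plane) :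
    pd1 (taylorTerm (k + 1) J) s = taylorTerm k (fun i j => J (i + 1) j) s := by
  rw [pd1, (hasFDerivAt_taylorTerm (k + 1) J s).fderiv, Finset.Nat.sum_antidiagonal_succ]
  simp [taylorTerm, _root_.sum_apply]
  refine Finset.sum_congr rfl fun p _ => ?_
  rw [Nat.factorial_succ]
  have := Nat.factorial_ne_zero p.1
  push_cast
  field_simp

theorem pd2_taylorTerm_succ (k : ℕ) (J : ℕ → ℕ → ℝ) (s : Plane) :
    pd2 (taylorTerm (k + 1) J) s = taylorTerm k (fun i j => J i (j + 1)) s := by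
  rw [pd2, (hasFDerivAt_taylorTerm (k + 1) J s).fderiv, Finset.Nat.sum_antidiagonal_succ']
  simp [taylorTerm, _root_.sum_apply]
  refine Finset.sum_congr rfl fun p _ => ?_
  rw [Nat.factorial_succ]
  have := Nat.factorial_ne_zero p.2
  push_cast
  field_simp

theorem taylorTerm_zero (J : ℕ → ℕ → ℝ) (s : Plane) : taylorTerm 0 J s = J 0 0 := by
  simp [taylorTerm]

theorem taylorTerm_succ_zero (k : ℕ) (J : ℕ → ℕ → ℝ) : taylorTerm (k + 1) J 0 = 0 := by
  refine Finset.sum_eq_zero fun p hp => ?_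
  rw [Finset.HasAntidiagonal.mem_antidiagonal] at hp
  rcases p with ⟨i, j⟩
  rcases i with _ | i
  · rcases j with _ | j
    · simp at hp
    · simp
  · simp

/-- The Taylor polynomial of degree `n` with the partial derivatives `J`. -/
noncomputable def taylorPoly (n : ℕ) (J : ℕ → ℕ → ℝ) (s : Plane) : ℝ :=
  ∑ k ∈ Finset.range (n + 1), taylorTerm k J s

theorem differentiable_taylorPoly (n : ℕ) (J : ℕ → ℕ → ℝ) :
    Differentiable ℝ (taylorPoly n J) := by
  unfold taylorPoly
  have := fun k => differentiable_taylorTerm k J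
  fun_prop

theorem fderiv_taylorPoly_succ (n : ℕ) (J : ℕ → ℕ → ℝ) (s : Plane) :
    fderiv ℝ (taylorPoly (n + 1) J) s
      = ∑ k ∈ Finset.range (n + 1), fderiv ℝ (taylorTerm (k + 1) J) s := by
  have h : taylorPoly (n + 1) J
      = fun s => ∑ k ∈ Finset.range (n + 1), taylorTerm (k + 1) J s + J 0 0 := by
    ext s
    simp only [taylorPoly, Finset.sum_range_succ' _ (n + 1), taylorTerm_zero]
  rw [h, fderiv_add_const, fderiv_fun_sum]
  intro k _
  exact (differentiable_taylorTerm _ _).differentiableAt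

theorem pd1_taylorPoly_succ (n : ℕ) (J : ℕ → ℕ → ℝ) (s : Plane) :
    pd1 (taylorPoly (n + 1) J) s = taylorPoly n (fun i j => J (i + 1) j) s := by
  rw [pd1, fderiv_taylorPoly_succ, _root_.sum_apply, taylorPoly]
  exact Finset.sum_congr rfl fun k _ => pd1_taylorTerm_succ k J s

theorem pd2_taylorPoly_succ (n : ℕ) (J : ℕ → ℕ → ℝ) (s : Plane) :
    pd2 (taylorPoly (n + 1) J) s = taylorPoly n (fun i j => J i (j + 1)) s := by
  rw [pd2, fderiv_taylorPoly_succ, _root_.sum_apply, taylorPoly]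
  exact Finset.sum_congr rfl fun k _ => pd2_taylorTerm_succ k J s

theorem taylorPoly_apply_zero (n : ℕ) (J : ℕ → ℕ → ℝ) : taylorPoly n J 0 = J 0 0 := by
  simp [taylorPoly, Finset.sum_range_succ', taylorTerm_zero, taylorTerm_succ_zero]

/-- Taylor's theorem at the origin of the plane. -/
theorem taylor_isLittleO_zero (n : ℕ) {g : Plane → ℝ} (hg : ContDiffAt ℝ ∞ g 0) :
    (fun s => g s - taylorPoly n (jet g 0) s) =o[𝓝 0] fun s : Plane => ‖s‖ ^ n := by
  induction n generalizing g with
  | zero =>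
    simp only [pow_zero]
    rw [isLittleO_one_iff]
    have h : ContinuousAt (fun s => g s - taylorPoly 0 (jet g 0) s) 0 :=
      hg.continuousAt.sub (differentiable_taylorPoly 0 _).continuous.continuousAt
    have := h.tendsto
    simpa [taylorPoly_apply_zero, jet] using this
  | succ n ih =>
    have hd : ∀ᶠ s in 𝓝 (0 : Plane), DifferentiableAt ℝ g s := by
      have h1 : ContDiffAt ℝ 1 g 0 := hg.of_le (by simp)
      filter_upwards [h1.eventually (by simp)] with s hs
      exact hs.differentiableAt (by simp)
    -- The partial derivatives of the remainder of order `n + 1` are the remainders of order `n` of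
    -- `pd1 g` and `pd2 g`, so the induction runs over all `g` at once.
    refine isLittleO_succ ?_ ?_ ?_ ?_
    · filter_upwards [hd] with s hs
      exact hs.sub (differentiable_taylorPoly _ _).differentiableAt
    · simp [taylorPoly_apply_zero, jet]
    · refine (ih (contDiffAt_pd1 hg)).congr' ?_ EventuallyEq.rfl
      filter_upwards [hd] with s hs
      have : pd1 (fun s => g s - taylorPoly (n + 1) (jet g 0) s) s
          = pd1 g s - pd1 (taylorPoly (n + 1) (jet g 0)) s := by
        rw [pd1, fderiv_fun_sub hs (differentiable_taylorPoly _ _).differentiableAt]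
        rfl
      rw [this, pd1_taylorPoly_succ]
      have e : jet (pd1 g) 0 = fun i j => jet g 0 (i + 1) j := by
        ext i j; exact jet_pd1 hg i j
      rw [e]
    · refine (ih (contDiffAt_pd2 hg)).congr' ?_ EventuallyEq.rfl
      filter_upwards [hd] with s hs
      have : pd2 (fun s => g s - taylorPoly (n + 1) (jet g 0) s) s
          = pd2 g s - pd2 (taylorPoly (n + 1) (jet g 0)) s := by
        rw [pd2, fderiv_fun_sub hs (differentiable_taylorPoly _ _).differentiableAt]
        rfl
      rw [this, pd2_taylorPoly_succ]
      rfl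

theorem jet_translate (g : Plane → ℝ) (u s : Plane) (i j : ℕ) :
    jet (fun s => g (u + s)) s i j = jet g (u + s) i j := by
  have h1 : ∀ h : Plane → ℝ, pd1 (fun s => h (u + s)) = fun s => pd1 h (u + s) := by
    intro h; ext s; simp only [pd1, fderiv_comp_add_left]
  have h2 : ∀ h : Plane → ℝ, pd2 (fun s => h (u + s)) = fun s => pd2 h (u + s) := by
    intro h; ext s; simp only [pd2, fderiv_comp_add_left]
  have h3 : pd2^[j] (fun s => g (u + s)) = fun s => (pd2^[j] g) (u + s) := by
    induction j with
    | zero => rfl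
    | succ j ih => rw [Function.iterate_succ_apply', ih, h2, Function.iterate_succ_apply']
  have h4 : pd1^[i] (fun s => (pd2^[j] g) (u + s)) = fun s => (pd1^[i] (pd2^[j] g)) (u + s) := by
    induction i with
    | zero => rfl
    | succ i ih => rw [Function.iterate_succ_apply', ih, h1, Function.iterate_succ_apply']
  rw [jet, h3, h4, jet]

/-- Taylor's theorem in the plane. -/
theorem taylor_isLittleO_plane (n : ℕ) {g : Plane → ℝ} {u : Plane} (hg : ContDiffAt ℝ ∞ g u) :
    (fun s => g (u + s) - taylorPoly n (jet g u) s) =o[𝓝 0] fun s : Plane => ‖s‖ ^ n := by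
  have h : ContDiffAt ℝ ∞ (fun s => g (u + s)) 0 := by
    refine ContDiffAt.comp (g := g) (f := fun s => u + s) 0 (by simpa using hg) (by fun_prop)
  have e : jet (fun s => g (u + s)) 0 = jet g u := by
    ext i j; rw [jet_translate]; simp
  have := taylor_isLittleO_zero n h
  rwa [e] at this

/-- A polynomial of degree at most `n` in one variable which is `o(tⁿ)` vanishes. -/
theorem coeff_eq_zero_of_isLittleO (n : ℕ) {a : ℕ → ℝ}
    (h : (fun t : ℝ => ∑ k ∈ Finset.range (n + 1), a k * t ^ k) =o[𝓝[≠] 0] fun t : ℝ => t ^ n) :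
    ∀ k ≤ n, a k = 0 := by
  induction n generalizing a with
  | zero =>
    intro k hk
    obtain rfl : k = 0 := by omega
    simp only [zero_add, Finset.range_one, Finset.sum_singleton, pow_zero, mul_one] at h
    rw [isLittleO_one_iff] at h
    exact tendsto_nhds_unique tendsto_const_nhds h
  | succ n ih =>
    have h0 : a 0 = 0 := by
      have h1 : Tendsto (fun t : ℝ => ∑ k ∈ Finset.range (n + 2), a k * t ^ k) (𝓝[≠] 0)
          (𝓝 (a 0)) := by
        have : Continuous (fun t : ℝ => ∑ k ∈ Finset.range (n + 2), a k * t ^ k) := by fun_prop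
        have h2 := this.tendsto 0
        simp only [Finset.sum_range_succ' _ (n + 1)] at h2
        simp only [Finset.sum_range_succ' _ (n + 1)]
        simpa using h2.mono_left nhdsWithin_le_nhds
      have h3 : Tendsto (fun t : ℝ => t ^ (n + 1)) (𝓝[≠] 0) (𝓝 0) := by
        have : Continuous (fun t : ℝ => t ^ (n + 1)) := by fun_prop
        simpa using (this.tendsto 0).mono_left nhdsWithin_le_nhds
      exact tendsto_nhds_unique h1 (h.trans_tendsto h3)
    -- With the constant term gone, one factor `t` can be cancelled; this is why the filter is the
    -- punctured neighbourhood.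
    have h1 : (fun t : ℝ => ∑ k ∈ Finset.range (n + 1), a (k + 1) * t ^ k) =o[𝓝[≠] 0]
        fun t : ℝ => t ^ n := by
      rw [isLittleO_iff] at h ⊢
      intro c hc
      filter_upwards [h hc, self_mem_nhdsWithin] with t ht ht0
      have ht0' : 0 < ‖t‖ := norm_pos_iff.2 ht0
      rw [Finset.sum_range_succ', h0, zero_mul, add_zero] at ht
      have e : ∑ k ∈ Finset.range (n + 1), a (k + 1) * t ^ (k + 1)
          = (∑ k ∈ Finset.range (n + 1), a (k + 1) * t ^ k) * t := by
        rw [Finset.sum_mul]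
        exact Finset.sum_congr rfl fun k _ => by ring
      rw [e, norm_mul, pow_succ, norm_mul, ← mul_assoc] at ht
      exact le_of_mul_le_mul_right ht ht0'
    intro k hk
    rcases k with _ | k
    · exact h0
    · exact ih h1 k (by omega)

theorem taylorTerm_smul (k : ℕ) (J : ℕ → ℕ → ℝ) (t : ℝ) (v : Plane) :
    taylorTerm k J (t • v) = taylorTerm k J v * t ^ k := by
  simp only [taylorTerm, Finset.sum_mul]
  refine Finset.sum_congr rfl fun p hp => ?_
  rw [Finset.HasAntidiagonal.mem_antidiagonal] at hp
  rw [← hp]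
  simp only [Prod.smul_fst, Prod.smul_snd, smul_eq_mul]
  ring

theorem isLittleO_line {r : Plane → ℝ} {n : ℕ} (h : r =o[𝓝 0] fun s : Plane => ‖s‖ ^ n)
    (v : Plane) : (fun t : ℝ => r (t • v)) =o[𝓝 0] fun t : ℝ => t ^ n := by
  have h1 : Tendsto (fun t : ℝ => t • v) (𝓝 0) (𝓝 0) := by
    have : Continuous (fun t : ℝ => t • v) := by fun_prop
    simpa using this.tendsto 0
  refine (h.comp_tendsto h1).trans_isBigO ?_
  refine IsBigO.of_bound (‖v‖ ^ n) (Eventually.of_forall fun t => ?_)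
  simp [norm_smul, mul_pow, mul_comm]

/-- A polynomial of degree at most `n` in the plane which is `o(|s|ⁿ)` vanishes. -/
theorem taylorPoly_coeff_eq_zero (n : ℕ) {J : ℕ → ℕ → ℝ}
    (h : taylorPoly n J =o[𝓝 0] fun s : Plane => ‖s‖ ^ n) (i j : ℕ) (hij : i + j ≤ n) :
    J i j = 0 := by
  -- On the line through `v` the homogeneous terms become the coefficients of a polynomial in one
  -- variable.
  have h1 : ∀ v : Plane, taylorTerm (i + j) J v = 0 := by
    intro v
    have h2 := (isLittleO_line h v).mono (nhdsWithin_le_nhds (s := {0}ᶜ))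
    simp only [taylorPoly, taylorTerm_smul] at h2
    exact coeff_eq_zero_of_isLittleO n h2 _ hij
  -- Evaluating the vanishing form at `(t, 1)` gives a polynomial in `t` whose coefficients are the
  -- entries of `J` up to factorials.
  have h3 : ∀ t : ℝ, ∑ k ∈ Finset.range (i + j + 1),
      J k (i + j - k) * ((k.factorial : ℝ)⁻¹ * ((i + j - k).factorial : ℝ)⁻¹) * t ^ k = 0 := by
    intro t
    rw [← h1 (t, 1), taylorTerm, Finset.Nat.sum_antidiagonal_eq_sum_range_succ_mk]
    refine Finset.sum_congr rfl fun k _ => ?_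
    simp only [one_pow]
    ring
  have h4 := coeff_eq_zero_of_isLittleO (i + j)
    (a := fun k => J k (i + j - k) * ((k.factorial : ℝ)⁻¹ * ((i + j - k).factorial : ℝ)⁻¹))
    (by simp only [h3]; exact isLittleO_zero _ _) i (by omega)
  simp only [Nat.add_sub_cancel_left] at h4
  have h5 := Nat.factorial_ne_zero i
  have h6 := Nat.factorial_ne_zero j
  simpa [h5, h6] using h4

theorem taylorPoly_sub (n : ℕ) (J K : ℕ → ℕ → ℝ) (s : Plane) :
    taylorPoly n (fun i j => J i j - K i j) s = taylorPoly n J s - taylorPoly n K s := by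
  simp only [taylorPoly, taylorTerm, sub_mul, Finset.sum_sub_distrib]

/-- Uniqueness of the Taylor polynomial. -/
theorem jet_eq_of_isLittleO (n : ℕ) {g : Plane → ℝ} {u : Plane} (hg : ContDiffAt ℝ ∞ g u)
    {J : ℕ → ℕ → ℝ}
    (h : (fun s => g (u + s) - taylorPoly n J s) =o[𝓝 0] fun s : Plane => ‖s‖ ^ n)
    (i j : ℕ) (hij : i + j ≤ n) : jet g u i j = J i j := by
  have h1 := h.sub (taylor_isLittleO_plane n hg)
  have h2 : taylorPoly n (fun i j => jet g u i j - J i j) =o[𝓝 0] fun s : Plane => ‖s‖ ^ n := by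
    refine h1.congr_left fun s => ?_
    rw [taylorPoly_sub]
    ring
  exact sub_eq_zero.1 (taylorPoly_coeff_eq_zero n h2 i j hij)

/-! ### The standard form as a jet. -/

/-- The partial derivatives of the standard form with curvatures `I`. -/
noncomputable def stdJet (I : Curvatures) : ℕ → ℕ → ℝ
  | 2, 0 => 1
  | 0, 2 => 1
  | 3, 0 => 1
  | 1, 2 => -1
  | 4, 0 => I.i40
  | 3, 1 => I.i31
  | 2, 2 => I.i22
  | 1, 3 => I.i13
  | 0, 4 => I.i04
  | _, _ => 0

theorem taylorPoly_three (J : ℕ → ℕ → ℝ) (s : Plane) :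
    taylorPoly 3 J s = J 0 0 + (J 1 0 * s.1 + J 0 1 * s.2)
      + (J 2 0 * s.1 ^ 2 + 2 * J 1 1 * s.1 * s.2 + J 0 2 * s.2 ^ 2) / 2
      + (J 3 0 * s.1 ^ 3 + 3 * J 2 1 * s.1 ^ 2 * s.2 + 3 * J 1 2 * s.1 * s.2 ^ 2
        + J 0 3 * s.2 ^ 3) / 6 := by
  simp [taylorPoly, taylorTerm, Finset.sum_range_succ,
    Finset.Nat.sum_antidiagonal_eq_sum_range_succ_mk, Nat.factorial]
  ring

theorem taylorPoly_four (J : ℕ → ℕ → ℝ) (s : Plane) :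
    taylorPoly 4 J s = taylorPoly 3 J s
      + (J 4 0 * s.1 ^ 4 + 4 * J 3 1 * s.1 ^ 3 * s.2 + 6 * J 2 2 * s.1 ^ 2 * s.2 ^ 2
        + 4 * J 1 3 * s.1 * s.2 ^ 3 + J 0 4 * s.2 ^ 4) / 24 := by
  rw [taylorPoly, Finset.sum_range_succ, ← taylorPoly]
  simp [taylorTerm, Finset.sum_range_succ,
    Finset.Nat.sum_antidiagonal_eq_sum_range_succ_mk, Nat.factorial]
  ring

theorem taylorPoly_three_stdJet (I : Curvatures) (s : Plane) :
    taylorPoly 3 (stdJet I) s = standardCubic s := by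
  rw [taylorPoly_three]
  simp [stdJet, standardCubic]
  ring

theorem taylorPoly_four_stdJet (I : Curvatures) (s : Plane) :
    taylorPoly 4 (stdJet I) s = standardCubic s + quarticTerm I s := by
  rw [taylorPoly_four, taylorPoly_three_stdJet]
  simp [stdJet, quarticTerm]

theorem isLittleO_pow_lt {m n : ℕ} (h : m < n) {r : Plane → ℝ}
    (hr : r =O[𝓝 0] fun s : Plane => ‖s‖ ^ n) : r =o[𝓝 0] fun s : Plane => ‖s‖ ^ m :=
  hr.trans_isLittleO ((isLittleO_pow_pow h).comp_tendsto
    (by simpa using (continuous_norm (E := Plane)).tendsto 0))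

theorem taylorTerm_isBigO (k : ℕ) (J : ℕ → ℕ → ℝ) :
    taylorTerm k J =O[𝓝 0] fun s : Plane => ‖s‖ ^ k := by
  refine IsBigO.fun_sum fun p hp => ?_
  rw [Finset.HasAntidiagonal.mem_antidiagonal] at hp
  have h1 : (fun s : Plane => s.1) =O[𝓝 0] fun s : Plane => ‖s‖ :=
    IsBigO.of_norm_le fun s => norm_fst_le s
  have h2 : (fun s : Plane => s.2) =O[𝓝 0] fun s : Plane => ‖s‖ :=
    IsBigO.of_norm_le fun s => norm_snd_le s
  have h3 := ((h1.pow p.1).const_mul_left (p.1.factorial : ℝ)⁻¹).mul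
    ((h2.pow p.2).const_mul_left (p.2.factorial : ℝ)⁻¹)
  refine (h3.const_mul_left (J p.1 p.2)).congr_right fun s => ?_
  rw [← hp, pow_add]

theorem HasCurvatures.isAdaptedFrame {S : Set A3} {p : A3} {e : Fin 3 → A3} {I : Curvatures}
    (h : HasCurvatures S p e I) : IsAdaptedFrame S p e := by
  obtain ⟨f, hf, ho⟩ := h
  refine ⟨f, hf, ?_⟩
  have hq : quarticTerm I =O[𝓝 0] fun s : Plane => ‖s‖ ^ 4 := by
    refine (taylorTerm_isBigO 4 (stdJet I)).congr_left fun s => ?_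
    have h1 := taylorPoly_four_stdJet I s
    rw [taylorPoly, Finset.sum_range_succ, ← taylorPoly, taylorPoly_three_stdJet] at h1
    linarith
  refine ((isLittleO_pow_lt (by norm_num) ho.isBigO).add
    (isLittleO_pow_lt (by norm_num) hq)).congr_left fun s => ?_
  ring

theorem IsLocalGraph.contDiffAt {S : Set A3} {p : A3} {e : Fin 3 → A3} {f : Plane → ℝ}
    (h : IsLocalGraph S p e f) : ContDiffAt ℝ ∞ f 0 := by
  obtain ⟨_, ε, hε, hf, _⟩ := h
  exact hf.contDiffAt (Metric.ball_mem_nhds _ hε)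

/-- `I` is a free parameter: up to order 3 `stdJet I` does not depend on it. -/
theorem jet_of_adapted {f : Plane → ℝ} (hf : ContDiffAt ℝ ∞ f 0)
    (h : (fun s : Plane => f s - standardCubic s) =o[𝓝 0] (fun s : Plane => ‖s‖ ^ 3))
    (I : Curvatures) (i j : ℕ) (hij : i + j ≤ 3) : jet f 0 i j = stdJet I i j := by
  refine jet_eq_of_isLittleO 3 hf ?_ i j hij
  simpa only [zero_add, taylorPoly_three_stdJet] using h

theorem jet_of_curvatures {f : Plane → ℝ} {I : Curvatures} (hf : ContDiffAt ℝ ∞ f 0)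
    (h : (fun s : Plane => f s - (standardCubic s + quarticTerm I s)) =o[𝓝 0]
      (fun s : Plane => ‖s‖ ^ 4)) (i j : ℕ) (hij : i + j ≤ 4) :
    jet f 0 i j = stdJet I i j := by
  refine jet_eq_of_isLittleO 4 hf ?_ i j hij
  simpa only [zero_add, taylorPoly_four_stdJet] using h

/-- Every adapted frame has curvatures. -/
theorem IsAdaptedFrame.exists_hasCurvatures {S : Set A3} {p : A3} {e : Fin 3 → A3}
    (h : IsAdaptedFrame S p e) : ∃ I, HasCurvatures S p e I := by
  obtain ⟨f, hf, ho⟩ := h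
  have hs := hf.contDiffAt
  let I : Curvatures := ⟨jet f 0 4 0, jet f 0 3 1, jet f 0 2 2, jet f 0 1 3, jet f 0 0 4⟩
  refine ⟨I, f, hf, ?_⟩
  have h1 := taylor_isLittleO_plane 4 hs
  refine h1.congr_left fun s => ?_
  have hJ := jet_of_adapted hs ho I
  rw [zero_add, taylorPoly_four, taylorPoly_three, ← taylorPoly_three_stdJet I,
    taylorPoly_three]
  simp only [hJ 0 0 (by norm_num), hJ 1 0 (by norm_num), hJ 0 1 (by norm_num),
    hJ 2 0 (by norm_num), hJ 1 1 (by norm_num), hJ 0 2 (by norm_num), hJ 3 0 (by norm_num),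
    hJ 2 1 (by norm_num), hJ 1 2 (by norm_num), hJ 0 3 (by norm_num)]
  rfl

/-! ### Arithmetic of third-order jets in one variable. -/

/-- `h` has the Taylor polynomial `a₀ + a₁ t + a₂ t² + a₃ t³` of order 3 at `0`. -/
def HasJet3 (h : ℝ → ℝ) (a₀ a₁ a₂ a₃ : ℝ) : Prop :=
  (fun t => h t - (a₀ + a₁ * t + a₂ * t ^ 2 + a₃ * t ^ 3)) =o[𝓝 0] fun t : ℝ => t ^ 3

/-- Absorbs the terms of degree 4 and more in the product of two cubic polynomials. -/
theorem isLittleO_pow_four (R : ℝ → ℝ) (hR : ContinuousAt R 0) :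
    (fun t => t ^ 4 * R t) =o[𝓝 0] fun t : ℝ => t ^ 3 := by
  have h1 : (fun t : ℝ => t ^ 4) =o[𝓝 0] fun t : ℝ => t ^ 3 := isLittleO_pow_pow (by norm_num)
  have h2 : R =O[𝓝 0] fun _ => (1 : ℝ) := hR.tendsto.isBigO_one ℝ
  simpa using h1.mul_isBigO h2

namespace HasJet3

variable {h k : ℝ → ℝ} {a₀ a₁ a₂ a₃ b₀ b₁ b₂ b₃ : ℝ}

theorem add (H : HasJet3 h a₀ a₁ a₂ a₃) (K : HasJet3 k b₀ b₁ b₂ b₃) :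
    HasJet3 (fun t => h t + k t) (a₀ + b₀) (a₁ + b₁) (a₂ + b₂) (a₃ + b₃) := by
  refine (IsLittleO.add H K).congr_left fun t => ?_
  ring

theorem const_mul (c : ℝ) (H : HasJet3 h a₀ a₁ a₂ a₃) :
    HasJet3 (fun t => c * h t) (c * a₀) (c * a₁) (c * a₂) (c * a₃) := by
  refine (IsLittleO.const_mul_left H c).congr_left fun t => ?_
  ring

theorem tendsto (H : HasJet3 h a₀ a₁ a₂ a₃) : Tendsto h (𝓝 0) (𝓝 a₀) := by
  have h1 : Tendsto (fun t : ℝ => t ^ 3) (𝓝 0) (𝓝 0) := by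
    have : Continuous (fun t : ℝ => t ^ 3) := by fun_prop
    simpa using this.tendsto 0
  have h2 : Tendsto (fun t : ℝ => a₀ + a₁ * t + a₂ * t ^ 2 + a₃ * t ^ 3) (𝓝 0) (𝓝 a₀) := by
    have : Continuous (fun t : ℝ => a₀ + a₁ * t + a₂ * t ^ 2 + a₃ * t ^ 3) := by fun_prop
    simpa using this.tendsto 0
  simpa using (IsLittleO.trans_tendsto H h1).add h2

theorem mul (H : HasJet3 h a₀ a₁ a₂ a₃) (K : HasJet3 k b₀ b₁ b₂ b₃) :
    HasJet3 (fun t => h t * k t) (a₀ * b₀) (a₀ * b₁ + a₁ * b₀) (a₀ * b₂ + a₁ * b₁ + a₂ * b₀)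
      (a₀ * b₃ + a₁ * b₂ + a₂ * b₁ + a₃ * b₀) := by
  have h1 := IsLittleO.mul_isBigO H (K.tendsto.isBigO_one ℝ)
  have h2 : (fun t : ℝ => a₀ + a₁ * t + a₂ * t ^ 2 + a₃ * t ^ 3) =O[𝓝 0] fun _ => (1 : ℝ) := by
    have : Continuous (fun t : ℝ => a₀ + a₁ * t + a₂ * t ^ 2 + a₃ * t ^ 3) := by fun_prop
    exact (this.tendsto 0).isBigO_one ℝ
  have h3 := h2.mul_isLittleO K
  have h4 := isLittleO_pow_four (fun t => (a₁ * b₃ + a₂ * b₂ + a₃ * b₁)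
    + (a₂ * b₃ + a₃ * b₂) * t + a₃ * b₃ * t ^ 2) (by fun_prop)
  simp only [mul_one, one_mul] at h1 h3
  refine ((h1.add h3).add h4).congr_left fun t => ?_
  ring

theorem eq_zero (H : HasJet3 h a₀ a₁ a₂ a₃) (h0 : h =o[𝓝 0] fun t : ℝ => t ^ 3) :
    a₀ = 0 ∧ a₁ = 0 ∧ a₂ = 0 ∧ a₃ = 0 := by
  have h1 : (fun t : ℝ => ∑ k ∈ Finset.range (3 + 1),
      (![a₀, a₁, a₂, a₃] : Fin 4 → ℝ) (Fin.ofNat 4 k) * t ^ k) =o[𝓝[≠] 0] fun t : ℝ => t ^ 3 := by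
    refine ((h0.sub H).mono nhdsWithin_le_nhds).congr_left fun t => ?_
    simp [Finset.sum_range_succ, Fin.ofNat]
  have h2 := coeff_eq_zero_of_isLittleO 3
    (a := fun k => (![a₀, a₁, a₂, a₃] : Fin 4 → ℝ) (Fin.ofNat 4 k)) h1
  exact ⟨h2 0 (by norm_num), h2 1 (by norm_num), h2 2 (by norm_num), h2 3 (by norm_num)⟩

end HasJet3

/-! ### The frame equations and their necessity. -/

/-- The differential of `ξ₃ - f (ξ₁, ξ₂)`, where `f` has the partial derivatives `J`. -/
def conormal (J : ℕ → ℕ → ℝ) (u : A3) : ℝ := u 2 - J 1 0 * u 0 - J 0 1 * u 1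

/-- The second derivative of a function of the first two coordinates. -/
def hess (J : ℕ → ℕ → ℝ) (u v : A3) : ℝ :=
  J 2 0 * (u 0 * v 0) + J 1 1 * (u 0 * v 1 + u 1 * v 0) + J 0 2 * (u 1 * v 1)

/-- The third derivative of a function of the first two coordinates. -/
def cub (J : ℕ → ℕ → ℝ) (u v w : A3) : ℝ :=
  J 3 0 * (u 0 * v 0 * w 0) + J 2 1 * (u 0 * v 0 * w 1 + u 0 * v 1 * w 0 + u 1 * v 0 * w 0)
    + J 1 2 * (u 0 * v 1 * w 1 + u 1 * v 0 * w 1 + u 1 * v 1 * w 0) + J 0 3 * (u 1 * v 1 * w 1)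

/-- The equations which express that the frame `m` brings the 3-jet of the graph of a function
with the partial derivatives `J` to the regular elliptical standard form. -/
structure FrameEqs (J : ℕ → ℕ → ℝ) (m : Fin 3 → A3) : Prop where
  tangent0 : conormal J (m 0) = 0
  tangent1 : conormal J (m 1) = 0
  hess00 : hess J (m 0) (m 0) = conormal J (m 2)
  hess01 : hess J (m 0) (m 1) = 0
  hess11 : hess J (m 1) (m 1) = conormal J (m 2)
  cub000 : cub J (m 0) (m 0) (m 0) + 3 * hess J (m 0) (m 2) = conormal J (m 2)
  cub001 : cub J (m 0) (m 0) (m 1) + hess J (m 1) (m 2) = 0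
  cub011 : cub J (m 0) (m 1) (m 1) + hess J (m 0) (m 2) = -conormal J (m 2)
  cub111 : cub J (m 1) (m 1) (m 1) + 3 * hess J (m 1) (m 2) = 0

/-- The hypotheses are the parts of degree 1, 2 and 3 in (x, y) of the surface equation at x m₀ + y
m₁ + z m₂, where z is the standard cubic polynomial in (x, y). The nine equations are their
polarizations, read off at (1, 0), (0, 1), (1, 1) and (1, -1). -/
theorem frameEqs_of_forall {J : ℕ → ℕ → ℝ} {m : Fin 3 → A3}
    (h1 : ∀ x y : ℝ, conormal J (x • m 0 + y • m 1) = 0)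
    (h2 : ∀ x y : ℝ, hess J (x • m 0 + y • m 1) (x • m 0 + y • m 1)
      = (x ^ 2 + y ^ 2) * conormal J (m 2))
    (h3 : ∀ x y : ℝ, cub J (x • m 0 + y • m 1) (x • m 0 + y • m 1) (x • m 0 + y • m 1)
      + 3 * (x ^ 2 + y ^ 2) * hess J (x • m 0 + y • m 1) (m 2)
      = (x ^ 3 - 3 * x * y ^ 2) * conormal J (m 2)) : FrameEqs J m := by
  have a10 := h1 1 0
  have a01 := h1 0 1
  have b10 := h2 1 0
  have b01 := h2 0 1
  have b11 := h2 1 1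
  have c10 := h3 1 0
  have c01 := h3 0 1
  have c11 := h3 1 1
  have c12 := h3 1 (-1)
  clear h1 h2 h3
  simp only [conormal, hess, cub, Pi.add_apply, Pi.smul_apply, smul_eq_mul] at *
  constructor <;> simp only [conormal, hess, cub]
  · linear_combination a10
  · linear_combination a01
  · linear_combination b10
  · linear_combination (b11 - b10 - b01) / 2
  · linear_combination b01
  · linear_combination c10
  · linear_combination (c11 - c12) / 6 - c01 / 3
  · linear_combination (c11 + c12) / 6 - c10 / 3
  · linear_combination c01

theorem hasJet3_mul_left (c : ℝ) : HasJet3 (fun t => c * t) 0 c 0 0 := by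
  refine (isLittleO_zero (fun t : ℝ => t ^ 3) (𝓝 0)).congr_left fun t => ?_
  ring

/-- An adapted frame satisfies the frame equations in the coordinates of any other frame in which
the surface is a graph. -/
theorem frameEqs_of_isAdaptedFrame {S : Set A3} {p : A3} {e : Fin 3 → A3} {f : Plane → ℝ} {ε : ℝ}
    (hf : ContDiffOn ℝ ∞ f (Metric.ball 0 ε))
    (hg : ∀ ξ : Fin 3 → ℝ, ‖ξ‖ < ε → (p + ∑ i, ξ i • e i ∈ S ↔ ξ 2 = f (ξ 0, ξ 1)))
    {x : A3} (hx : ‖x‖ < ε) (hxS : x 2 = f (x 0, x 1)) {m : Fin 3 → A3}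
    (hm : IsAdaptedFrame S (p + ∑ i, x i • e i) (fun j => ∑ i, m j i • e i)) :
    FrameEqs (jet f (x 0, x 1)) m := by
  obtain ⟨g, ⟨hind, δ, hδ, hgs, hgg⟩, ho⟩ := hm
  have hgc : ContDiffAt ℝ ∞ g 0 := hgs.contDiffAt (Metric.ball_mem_nhds _ hδ)
  have hfx : ContDiffAt ℝ ∞ f (x 0, x 1) := by
    refine hf.contDiffAt (Metric.isOpen_ball.mem_nhds ?_)
    rw [mem_ball_zero_iff]
    refine lt_of_le_of_lt ?_ hx
    exact max_le (norm_le_pi_norm x 0) (norm_le_pi_norm x 1)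
  set J := jet f (x 0, x 1) with hJ
  have key : ∀ v : Plane,
      conormal J (v.1 • m 0 + v.2 • m 1) = 0 ∧
      hess J (v.1 • m 0 + v.2 • m 1) (v.1 • m 0 + v.2 • m 1)
        = (v.1 ^ 2 + v.2 ^ 2) * conormal J (m 2) ∧
      cub J (v.1 • m 0 + v.2 • m 1) (v.1 • m 0 + v.2 • m 1) (v.1 • m 0 + v.2 • m 1)
        + 3 * (v.1 ^ 2 + v.2 ^ 2) * hess J (v.1 • m 0 + v.2 • m 1) (m 2)
        = (v.1 ^ 3 - 3 * v.1 * v.2 ^ 2) * conormal J (m 2) := by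
    -- It suffices to compare expansions in `t` along the line `t • v` in the parameter plane of the
    -- adapted frame.
    intro v
    have hz : HasJet3 (fun t => g (t • v)) 0 0 ((v.1 ^ 2 + v.2 ^ 2) / 2)
        ((v.1 ^ 3 - 3 * v.1 * v.2 ^ 2) / 6) := by
      refine (isLittleO_line ho v).congr_left fun t => ?_
      simp only [standardCubic, Prod.smul_fst, Prod.smul_snd, smul_eq_mul]
      ring
    let η : ℝ → A3 := fun t => ![v.1 * t, v.2 * t, g (t • v)]
    -- The point with coordinates `η t` in the adapted frame has coordinates `x + y t` in the frame
    -- `e`.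
    let y : Fin 3 → ℝ → ℝ := fun i t => m 0 i * (v.1 * t) + m 1 i * (v.2 * t) + m 2 i * g (t • v)
    have hy : ∀ i, HasJet3 (y i) _ _ _ _ := fun i =>
      (((hasJet3_mul_left v.1).const_mul (m 0 i)).add
        ((hasJet3_mul_left v.2).const_mul (m 1 i))).add (hz.const_mul (m 2 i))
    have hy0 : ∀ i, Tendsto (y i) (𝓝 0) (𝓝 0) := fun i => by simpa using (hy i).tendsto
    have hη : Tendsto η (𝓝 0) (𝓝 0) := by
      refine tendsto_pi_nhds.2 fun i => ?_
      fin_cases i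
      · simpa [η] using (hasJet3_mul_left v.1).tendsto
      · simpa [η] using (hasJet3_mul_left v.2).tendsto
      · simpa [η] using hz.tendsto
    have hxy : Tendsto (fun t => x + fun i => y i t) (𝓝 0) (𝓝 x) := by
      have : Tendsto (fun t => fun i => y i t) (𝓝 0) (𝓝 (0 : A3)) := tendsto_pi_nhds.2 hy0
      simpa using tendsto_const_nhds.add this
    -- This point lies on `S` by the adapted description, hence it satisfies the equation of the
    -- graph of `f`.
    have hev : ∀ᶠ t in 𝓝 (0 : ℝ),
        x 2 + y 2 t = f ((x 0, x 1) + (y 0 t, y 1 t)) := by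
      have e1 : ∀ᶠ t in 𝓝 (0 : ℝ), ‖η t‖ < δ := by
        have := hη.norm; rw [norm_zero] at this
        exact this.eventually_lt_const hδ
      have e2 : ∀ᶠ t in 𝓝 (0 : ℝ), ‖x + fun i => y i t‖ < ε :=
        hxy.norm.eventually_lt_const hx
      have e3 : ∀ᶠ t in 𝓝 (0 : ℝ), t • v ∈ Metric.ball (0 : Plane) δ := by
        have : Continuous (fun t : ℝ => t • v) := by fun_prop
        have := this.tendsto 0
        rw [zero_smul] at this
        exact this.eventually_mem (Metric.ball_mem_nhds _ hδ)
      filter_upwards [e1, e2] with t h1 h2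
      have hmem := (hgg (η t) h1).2 (by
        simp only [η, Matrix.cons_val]
        congr 1
        ext <;> simp [mul_comm])
      have heq : p + ∑ i, x i • e i + ∑ i, η t i • (fun j => ∑ i, m j i • e i) i
          = p + ∑ i, (x + fun i => y i t) i • e i := by
        simp only [Fin.sum_univ_three, η, y, Pi.add_apply, Matrix.cons_val]
        module
      rw [heq] at hmem
      simpa using (hg _ h2).1 hmem
    have hT := (taylor_isLittleO_plane 3 hfx)
    have hyO : (fun t => ((y 0 t, y 1 t) : Plane)) =O[𝓝 0] fun t : ℝ => t := by
      have : ∀ i, y i =O[𝓝 0] fun t : ℝ => t := by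
        intro i
        have h1 := hy i
        have h2 : (fun t : ℝ => t ^ 3) =O[𝓝 0] fun t : ℝ => t := by
          simpa using (isLittleO_pow_pow (𝕜 := ℝ) (m := 1) (n := 3) (by norm_num)).isBigO
        have h3 := (IsLittleO.isBigO h1).trans h2
        have h4 : (fun t : ℝ => t ^ 2) =O[𝓝 0] fun t : ℝ => t := by
          simpa using (isLittleO_pow_pow (𝕜 := ℝ) (m := 1) (n := 2) (by norm_num)).isBigO
        have h5 := ((isBigO_refl (fun t : ℝ => t) (𝓝 0)).const_mul_left
          (m 0 i * v.1 + m 1 i * v.2)).add ((h4.const_mul_left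
            (m 2 i * ((v.1 ^ 2 + v.2 ^ 2) / 2))).add (h2.const_mul_left
            (m 2 i * ((v.1 ^ 3 - 3 * v.1 * v.2 ^ 2) / 6))))
        refine (h3.add h5).congr_left fun t => ?_
        ring
      exact (this 0).prod_left (this 1)
    have hyt : Tendsto (fun t => ((y 0 t, y 1 t) : Plane)) (𝓝 0) (𝓝 0) :=
      (hy0 0).prodMk_nhds (hy0 1)
    have hρ := (hT.comp_tendsto hyt).trans_isBigO (hyO.norm_left.pow 3)
    have y0 := hy 0
    have y1 := hy 1
    have y00 := y0.mul y0
    have y01 := y0.mul y1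
    have y11 := y1.mul y1
    have P1 := (y0.const_mul (-J 1 0)).add (y1.const_mul (-J 0 1))
    have P2 := ((y00.const_mul (-J 2 0 / 2)).add (y01.const_mul (-J 1 1))).add
      (y11.const_mul (-J 0 2 / 2))
    have P3 := (((y00.mul y0).const_mul (-J 3 0 / 6)).add ((y00.mul y1).const_mul (-J 2 1 / 2))).add
      (((y0.mul y11).const_mul (-J 1 2 / 2)).add ((y11.mul y1).const_mul (-J 0 3 / 6)))
    -- The surface equation with `f` replaced by its Taylor polynomial. It equals the Taylor
    -- remainder along the curve, which is o(t³), so its coefficients of t, t², t³ vanish.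
    have hG := (((hy 2).add P1).add P2).add P3
    obtain ⟨-, q1, q2, q3⟩ := hG.eq_zero (by
      refine hρ.congr' ?_ EventuallyEq.rfl
      filter_upwards [hev] with t ht
      have hJ0 : J 0 0 = f (x 0, x 1) := rfl
      simp only [Function.comp_apply, ← hJ]
      rw [← ht, taylorPoly_three, hxS, ← hJ0]
      ring)
    simp only [conormal, hess, cub, Pi.add_apply, Pi.smul_apply, smul_eq_mul]
    refine ⟨?_, ?_, ?_⟩
    · linear_combination q1
    · linear_combination -2 * q2
    · linear_combination -6 * q3
  exact frameEqs_of_forall (fun x y => (key (x, y)).1) (fun x y => (key (x, y)).2.1)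
    (fun x y => (key (x, y)).2.2)

/-! ### Uniqueness of solutions up to the symmetries of the triangle. -/

theorem exists_coords {m : Fin 3 → A3} (hm : LinearIndependent ℝ m) (v : A3) :
    ∃ c : Fin 3 → ℝ, v = c 0 • m 0 + c 1 • m 1 + c 2 • m 2 := by
  let b := basisOfLinearIndependentOfCardEqFinrank hm (by simp)
  refine ⟨b.repr v, ?_⟩
  have := (b.sum_repr v).symm
  simpa [Fin.sum_univ_three, b] using this

theorem conormal_add_smul (J : ℕ → ℕ → ℝ) (u v w : A3) (a b c : ℝ) :
    conormal J (a • u + b • v + c • w)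
      = a * conormal J u + b * conormal J v + c * conormal J w := by
  simp only [conormal, Pi.add_apply, Pi.smul_apply, smul_eq_mul]
  ring

/-- Otherwise `conormal J` would vanish on a basis, while it takes the value 1 on the third
coordinate vector. -/
theorem FrameEqs.conormal_ne_zero {J : ℕ → ℕ → ℝ} {m : Fin 3 → A3} (H : FrameEqs J m)
    (hm : LinearIndependent ℝ m) : conormal J (m 2) ≠ 0 := by
  intro h
  obtain ⟨c, hc⟩ := exists_coords hm ![0, 0, 1]
  have h1 : conormal J ![0, 0, 1] = 0 := by
    rw [hc, conormal_add_smul, H.tangent0, H.tangent1, h]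
    ring
  simp [conormal] at h1

/-- A linear change of frame of the tangent plane which is compatible with the standard 3-jet
belongs to the symmetry group of the triangle. -/
theorem d3_of_equations {a b c d g h k : ℝ} (hk : k ≠ 0) (h00 : a ^ 2 + b ^ 2 = k)
    (h01 : a * c + b * d = 0) (h11 : c ^ 2 + d ^ 2 = k)
    (c000 : a ^ 3 - 3 * a * b ^ 2 + 3 * (a * g + b * h) = k)
    (c001 : a ^ 2 * c - 2 * a * b * d - b ^ 2 * c + (c * g + d * h) = 0)
    (c011 : a * c ^ 2 - a * d ^ 2 - 2 * b * c * d + (a * g + b * h) = -k)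
    (c111 : c ^ 3 - 3 * c * d ^ 2 + 3 * (c * g + d * h) = 0) :
    ((a = 1 ∧ b = 0) ∨ (a = -1 / 2 ∧ b = √3 / 2) ∨ (a = -1 / 2 ∧ b = -√3 / 2)) ∧
    ∃ δ : ℝ, (δ = 1 ∨ δ = -1) ∧ c = δ * -b ∧ d = δ * a ∧ g = 0 ∧ h = 0 ∧ k = 1 := by
  -- The matrix with rows `(a, b)`, `(c, d)` is a similarity of ratio √k; the sign `δ` of its
  -- determinant expresses the second row through the first.
  have hdet : (a * d - b * c) ^ 2 = k ^ 2 := by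
    linear_combination (c ^ 2 + d ^ 2) * h00 + k * h11 - (a * c + b * d) * h01
  obtain ⟨δ, hδ, hab⟩ : ∃ δ : ℝ, (δ = 1 ∨ δ = -1) ∧ a * d - b * c = δ * k := by
    rcases sq_eq_sq_iff_eq_or_eq_neg.1 hdet with h1 | h1
    · exact ⟨1, Or.inl rfl, by rw [h1]; ring⟩
    · exact ⟨-1, Or.inr rfl, by rw [h1]; ring⟩
  have hc : c = δ * -b := by
    apply mul_left_cancel₀ hk
    linear_combination a * h01 - b * hab - c * h00
  have hd : d = δ * a := by
    apply mul_left_cancel₀ hk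
    linear_combination b * h01 + a * hab - d * h00
  have hδ2 : δ ^ 2 = 1 := by rcases hδ with h1 | h1 <;> rw [h1] <;> norm_num
  subst hc hd
  -- The standard cubic is harmonic, so the trace of the cubic equations leaves only `4 * (a * g + b
  -- * h) = 0`.
  have g1 : a * g + b * h = 0 := by
    linear_combination (c000 + c011) / 4 - (a * b ^ 2 - a ^ 3 + 2 * a * b ^ 2) / 4 * hδ2
  have hδ0 : δ ≠ 0 := by rcases hδ with h1 | h1 <;> rw [h1] <;> norm_num
  have g2 : -b * g + a * h = 0 := by
    apply mul_left_cancel₀ hδ0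
    linear_combination (c001 + c111) / 4 - δ * (-b ^ 3 + 3 * a ^ 2 * b) / 4 * hδ2
  have hg : g = 0 := by
    apply mul_left_cancel₀ hk
    linear_combination a * g1 - b * g2 - g * h00
  have hh : h = 0 := by
    apply mul_left_cancel₀ hk
    linear_combination b * g1 + a * g2 - h * h00
  subst hg hh
  -- What is left says (a + ib)³ = |a + ib|² = k with k nonzero, so a + ib is a cube root of unity.
  -- The equation below is the vanishing of the imaginary part.
  have e1 : b * (b ^ 2 - 3 * a ^ 2) = 0 := by
    apply mul_left_cancel₀ hδ0
    linear_combination c001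
  rcases mul_eq_zero.1 e1 with hb | hb
  · subst hb
    have ha : a ≠ 0 := by
      rintro rfl
      apply hk
      linear_combination -h00
    have ha1 : a = 1 := by
      apply mul_left_cancel₀ (pow_ne_zero 2 ha)
      linear_combination c000 - h00
    refine ⟨Or.inl ⟨ha1, rfl⟩, δ, hδ, rfl, rfl, rfl, rfl, ?_⟩
    rw [← h00, ha1]
    norm_num
  · have ha : a ≠ 0 := by
      rintro rfl
      apply hk
      linear_combination -h00 + hb
    have ha1 : a = -1 / 2 := by
      apply mul_left_cancel₀ (pow_ne_zero 2 ha)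
      linear_combination (-c000 + h00) / 8 - (3 * a + 1) / 8 * hb
    have hb2 : b ^ 2 = (√3 / 2) ^ 2 := by
      rw [div_pow, Real.sq_sqrt (by norm_num)]
      rw [ha1] at hb
      linear_combination hb
    refine ⟨Or.inr ?_, δ, hδ, rfl, rfl, rfl, rfl, ?_⟩
    · rcases sq_eq_sq_iff_eq_or_eq_neg.1 hb2 with h1 | h1
      · exact Or.inl ⟨ha1, h1⟩
      · exact Or.inr ⟨ha1, by rw [h1]; ring⟩
    · rw [← h00, hb2, ha1, div_pow √3, Real.sq_sqrt (by norm_num)]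
      norm_num

/-- The solutions of the frame equations are unique up to the symmetry group of the triangle. -/
theorem FrameEqs.isD3Related {J : ℕ → ℕ → ℝ} {m m' : Fin 3 → A3} (H : FrameEqs J m)
    (H' : FrameEqs J m') (hm : LinearIndependent ℝ m) (hm' : LinearIndependent ℝ m') :
    IsD3Related m m' := by
  have hκ := H.conormal_ne_zero hm
  have hκ' := H'.conormal_ne_zero hm'
  obtain ⟨x, hx⟩ := exists_coords hm (m' 0)
  obtain ⟨y, hy⟩ := exists_coords hm (m' 1)
  obtain ⟨z, hz⟩ := exists_coords hm (m' 2)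
  obtain ⟨t0, t1, h00, h01, h11, c000, c001, c011, c111⟩ := H
  obtain ⟨t0', t1', h00', h01', h11', c000', c001', c011', c111'⟩ := H'
  set κ := conormal J (m 2) with hκd
  -- The first two vectors of both frames are tangent, so `m' 0` and `m' 1` have no component along
  -- `m 2`.
  have hx2 : x 2 = 0 := by
    rw [hx, conormal_add_smul, t0, t1] at t0'
    simpa [← hκd, hκ] using t0'
  have hy2 : y 2 = 0 := by
    rw [hy, conormal_add_smul, t0, t1] at t1'
    simpa [← hκd, hκ] using t1'
  have hz2 : conormal J (m' 2) = z 2 * κ := by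
    rw [hz, conormal_add_smul, t0, t1]
    ring
  have hz2' : z 2 ≠ 0 := by
    rintro h
    rw [h, zero_mul] at hz2
    exact hκ' hz2
  rw [hx2, zero_smul, add_zero] at hx
  rw [hy2, zero_smul, add_zero] at hy
  rw [hz2] at h00' h11' c000' c011'
  rw [hx] at h00' h01' c000' c001' c011'
  rw [hy] at h01' h11' c001' c011' c111'
  rw [hz] at c000' c001' c011' c111'
  clear_value κ
  clear t0 t1 t0' t1' hκ' hz2 hκd hx2 hy2
  simp only [hess, cub, Pi.add_apply, Pi.smul_apply, smul_eq_mul] at *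
  -- The values of the Hessian on `(m 0, m 2)` and `(m 1, m 2)` are not prescribed. They enter
  -- through the cubic terms and through `m' 2`, and the two contributions cancel by `e00`, `e01`,
  -- `e11`.
  obtain ⟨H0, hH0⟩ : ∃ H0, J 2 0 * (m 0 0 * m 2 0) + J 1 1 * (m 0 0 * m 2 1 + m 0 1 * m 2 0) + J 0 2 * (m 0 1 * m 2 1) = H0 :=
    ⟨_, rfl⟩
  obtain ⟨H1, hH1⟩ : ∃ H1, J 2 0 * (m 1 0 * m 2 0) + J 1 1 * (m 1 0 * m 2 1 + m 1 1 * m 2 0) + J 0 2 * (m 1 1 * m 2 1) = H1 :=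
    ⟨_, rfl⟩
  rw [hH0] at c000 c011
  rw [hH1] at c001 c111
  have e00 : x 0 ^ 2 + x 1 ^ 2 = z 2 := by
    apply mul_left_cancel₀ hκ
    linear_combination h00' - x 0 ^ 2 * h00 - 2 * x 0 * x 1 * h01 - x 1 ^ 2 * h11
  have e01 : x 0 * y 0 + x 1 * y 1 = 0 := by
    apply mul_left_cancel₀ hκ
    linear_combination h01' - x 0 * y 0 * h00 - (x 0 * y 1 + x 1 * y 0) * h01 - x 1 * y 1 * h11
  have e11 : y 0 ^ 2 + y 1 ^ 2 = z 2 := by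
    apply mul_left_cancel₀ hκ
    linear_combination h11' - y 0 ^ 2 * h00 - 2 * y 0 * y 1 * h01 - y 1 ^ 2 * h11
  have := d3_of_equations (a := x 0) (b := x 1) (c := y 0) (d := y 1) (g := z 0) (h := z 1)
    (k := z 2) hz2' e00 e01 e11 ?_ ?_ ?_ ?_
  · obtain ⟨h1, δ, hδ, hc, hd, hg, hh, hk⟩ := this
    refine ⟨x 0, x 1, δ, h1, hδ, hx, ?_, ?_⟩
    · rw [hy, hc, hd]
      module
    · rw [hz, hg, hh, hk]
      module
  · apply mul_left_cancel₀ hκ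
    linear_combination c000' - (x 0 * x 0 * x 0 * c000
          + x 0 * x 0 * x 1 * c001
          + x 0 * x 1 * x 0 * c001
          + x 0 * x 1 * x 1 * c011
          + x 1 * x 0 * x 0 * c001
          + x 1 * x 0 * x 1 * c011
          + x 1 * x 1 * x 0 * c011
          + x 1 * x 1 * x 1 * c111)
      - 3 * (x 0 * z 0 * h00 + (x 0 * z 1 + x 1 * z 0) * h01 + x 1 * z 1 * h11)
      + 3 * (x 0 * H0 + x 1 * H1) * e00 - 3 * z 2 * (x 0 * hH0 + x 1 * hH1)
  · apply mul_left_cancel₀ hκ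
    linear_combination c001' - (x 0 * x 0 * y 0 * c000
          + x 0 * x 0 * y 1 * c001
          + x 0 * x 1 * y 0 * c001
          + x 0 * x 1 * y 1 * c011
          + x 1 * x 0 * y 0 * c001
          + x 1 * x 0 * y 1 * c011
          + x 1 * x 1 * y 0 * c011
          + x 1 * x 1 * y 1 * c111)
      - (y 0 * z 0 * h00 + (y 0 * z 1 + y 1 * z 0) * h01 + y 1 * z 1 * h11)
      + (y 0 * H0 + y 1 * H1) * e00 + 2 * (x 0 * H0 + x 1 * H1) * e01
      - z 2 * (y 0 * hH0 + y 1 * hH1)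
  · apply mul_left_cancel₀ hκ
    linear_combination c011' - (x 0 * y 0 * y 0 * c000
          + x 0 * y 0 * y 1 * c001
          + x 0 * y 1 * y 0 * c001
          + x 0 * y 1 * y 1 * c011
          + x 1 * y 0 * y 0 * c001
          + x 1 * y 0 * y 1 * c011
          + x 1 * y 1 * y 0 * c011
          + x 1 * y 1 * y 1 * c111)
      - (x 0 * z 0 * h00 + (x 0 * z 1 + x 1 * z 0) * h01 + x 1 * z 1 * h11)
      + (x 0 * H0 + x 1 * H1) * e11 + 2 * (y 0 * H0 + y 1 * H1) * e01
      - z 2 * (x 0 * hH0 + x 1 * hH1)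
  · apply mul_left_cancel₀ hκ
    linear_combination c111' - (y 0 * y 0 * y 0 * c000
          + y 0 * y 0 * y 1 * c001
          + y 0 * y 1 * y 0 * c001
          + y 0 * y 1 * y 1 * c011
          + y 1 * y 0 * y 0 * c001
          + y 1 * y 0 * y 1 * c011
          + y 1 * y 1 * y 0 * c011
          + y 1 * y 1 * y 1 * c111)
      - 3 * (y 0 * z 0 * h00 + (y 0 * z 1 + y 1 * z 0) * h01 + y 1 * z 1 * h11)
      + 3 * (y 0 * H0 + y 1 * H1) * e11 - 3 * z 2 * (y 0 * hH0 + y 1 * hH1)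

/-! ### Adapted frames in graph coordinates. -/

/-- The frame whose vectors have the coordinates `m` with respect to the frame `e`. -/
def comb (e m : Fin 3 → A3) : Fin 3 → A3 := fun j => ∑ i, m j i • e i

theorem comb_eq_comp (e m : Fin 3 → A3) : comb e m = Fintype.linearCombination ℝ e ∘ m := by
  ext1 j
  simp [comb, Fintype.linearCombination_apply]

theorem linearIndependent_of_comb {e m : Fin 3 → A3} (h : LinearIndependent ℝ (comb e m)) :
    LinearIndependent ℝ m := by
  rw [comb_eq_comp] at h
  exact h.of_comp _

theorem exists_comb {e : Fin 3 → A3} (he : LinearIndependent ℝ e) (e' : Fin 3 → A3) :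
    ∃ m, comb e m = e' := by
  choose m hm using fun j => exists_coords he (e' j)
  refine ⟨m, ?_⟩
  ext1 j
  rw [hm j, comb, Fin.sum_univ_three]

theorem IsD3Related.comb {m m' : Fin 3 → A3} (h : IsD3Related m m') (e : Fin 3 → A3) :
    IsD3Related (comb e m) (comb e m') := by
  obtain ⟨c, s, δ, h1, h2, h3, h4, h5⟩ := h
  refine ⟨c, s, δ, h1, h2, ?_, ?_, ?_⟩
  · simp only [GenAffine.comb, h3, Fin.sum_univ_three, Pi.add_apply, Pi.smul_apply, smul_eq_mul]
    module
  · simp only [GenAffine.comb, h4, Fin.sum_univ_three, Pi.add_apply, Pi.smul_apply, smul_eq_mul]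
    module
  · simp only [GenAffine.comb, h5]

/-- The real form of |c + is| = 1 and (c + is)³ = 1, which is what the invariance of the standard
cubic polynomial requires. -/
theorem d3_identities {c s : ℝ}
    (h : (c = 1 ∧ s = 0) ∨ (c = -1 / 2 ∧ s = √3 / 2) ∨ (c = -1 / 2 ∧ s = -√3 / 2)) :
    c ^ 2 + s ^ 2 = 1 ∧ c ^ 3 - 3 * c * s ^ 2 = 1 ∧ s * (3 * c ^ 2 - s ^ 2) = 0 := by
  have h3 : √3 ^ 2 = 3 := Real.sq_sqrt (by norm_num)
  rcases h with ⟨rfl, rfl⟩ | ⟨rfl, rfl⟩ | ⟨rfl, rfl⟩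
  · norm_num
  · refine ⟨?_, ?_, ?_⟩
    · linear_combination h3 / 4
    · linear_combination 3 / 8 * h3
    · linear_combination -√3 / 8 * h3
  · refine ⟨?_, ?_, ?_⟩
    · linear_combination h3 / 4
    · linear_combination 3 / 8 * h3
    · linear_combination √3 / 8 * h3

/-- The symmetries of the triangle preserve adapted frames. -/
theorem IsAdaptedFrame.of_isD3Related {S : Set A3} {p : A3} {e e' : Fin 3 → A3}
    (h : IsAdaptedFrame S p e) (hd : IsD3Related e e') : IsAdaptedFrame S p e' := by
  obtain ⟨f, ⟨hind, ε, hε, hf, hg⟩, ho⟩ := h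
  obtain ⟨c, s, δ, hcs, hδ, h0, h1, h2⟩ := hd
  obtain ⟨i1, i2, i3⟩ := d3_identities hcs
  have hδ2 : δ ^ 2 = 1 := by rcases hδ with h1 | h1 <;> rw [h1] <;> norm_num
  have hc1 : |c| ≤ 1 := by
    rw [← sq_le_one_iff_abs_le_one]
    nlinarith [sq_nonneg s]
  have hs1 : |s| ≤ 1 := by
    rw [← sq_le_one_iff_abs_le_one]
    nlinarith [sq_nonneg c]
  have hδ1 : |δ| = 1 := by rcases hδ with h1 | h1 <;> simp [h1]
  have hb1 : ∀ x y : ℝ, |c * x - δ * s * y| ≤ |x| + |y| := by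
    intro x y
    refine (abs_sub _ _).trans ?_
    rw [abs_mul, abs_mul, abs_mul, hδ1, one_mul]
    nlinarith [abs_nonneg x, abs_nonneg y]
  have hb2 : ∀ x y : ℝ, |s * x + δ * c * y| ≤ |x| + |y| := by
    intro x y
    refine (abs_add_le _ _).trans ?_
    rw [abs_mul, abs_mul, abs_mul, hδ1, one_mul]
    nlinarith [abs_nonneg x, abs_nonneg y]
  -- `R` turns tangential coordinates in `e'` into tangential coordinates in `e`.
  let R : Plane → Plane := fun v => (c * v.1 - δ * s * v.2, s * v.1 + δ * c * v.2)
  have hR : ∀ v, ‖R v‖ ≤ 2 * ‖v‖ := by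
    intro v
    have h1 : |v.1| ≤ ‖v‖ := norm_fst_le v
    have h2 : |v.2| ≤ ‖v‖ := norm_snd_le v
    refine max_le ((hb1 _ _).trans ?_) ((hb2 _ _).trans ?_) <;> linarith
  have hRc : ContDiff ℝ ∞ R := by fun_prop
  have hlin : LinearIndependent ℝ e' := by
    rw [Fintype.linearIndependent_iff] at hind ⊢
    intro g hg0
    have := hind ![c * g 0 - δ * s * g 1, s * g 0 + δ * c * g 1, g 2] (by
      rw [← hg0]
      simp only [Fin.sum_univ_three, h0, h1, h2, Matrix.cons_val]
      module)
    have k0 := this 0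
    have k1 := this 1
    have k2 := this 2
    simp only [Matrix.cons_val] at k0 k1 k2
    have g0 : g 0 = 0 := by linear_combination c * k0 + s * k1 - g 0 * i1
    have g1 : g 1 = 0 := by
      linear_combination -δ * s * k0 + δ * c * k1 - g 1 * δ ^ 2 * i1 - g 1 * hδ2
    intro i
    fin_cases i
    · exact g0
    · exact g1
    · exact k2
  -- The sup norm is not rotation invariant; `R` at most doubles it, hence the radius `ε / 2`.
  refine ⟨f ∘ R, ⟨hlin, ε / 2, by positivity, ?_, ?_⟩, ?_⟩
  · refine hf.comp hRc.contDiffOn fun v hv => ?_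
    rw [mem_ball_zero_iff] at hv ⊢
    linarith [hR v]
  · intro ξ hξ
    have hn : ‖(![c * ξ 0 - δ * s * ξ 1, s * ξ 0 + δ * c * ξ 1, ξ 2] : Fin 3 → ℝ)‖ < ε := by
      rw [pi_norm_lt_iff hε]
      have n0 : |ξ 0| ≤ ‖ξ‖ := norm_le_pi_norm ξ 0
      have n1 : |ξ 1| ≤ ‖ξ‖ := norm_le_pi_norm ξ 1
      have n2 : |ξ 2| ≤ ‖ξ‖ := norm_le_pi_norm ξ 2
      intro i
      fin_cases i
      · exact (hb1 _ _).trans_lt (by linarith)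
      · exact (hb2 _ _).trans_lt (by linarith)
      · exact n2.trans_lt (by linarith [norm_nonneg ξ])
    have := hg _ hn
    simp only [Matrix.cons_val] at this
    rw [Function.comp_apply, ← this]
    have e1 : p + ∑ i, ξ i • e' i = p + ∑ i,
        (![c * ξ 0 - δ * s * ξ 1, s * ξ 0 + δ * c * ξ 1, ξ 2] : Fin 3 → ℝ) i • e i := by
      simp only [Fin.sum_univ_three, h0, h1, h2, Matrix.cons_val]
      module
    rw [e1]
  · have ht : Tendsto R (𝓝 0) (𝓝 0) := by
      have h00 : R 0 = 0 := by simp [R]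
      have := hRc.continuous.tendsto 0
      rwa [h00] at this
    have hO : (fun v => ‖R v‖) =O[𝓝 0] fun v : Plane => ‖v‖ :=
      IsBigO.of_bound 2 (Eventually.of_forall fun v => by simpa using hR v)
    refine ((ho.comp_tendsto ht).trans_isBigO (hO.pow 3)).congr_left fun v => ?_
    simp only [Function.comp_apply, standardCubic, R]
    linear_combination -(v.1 ^ 2 + v.2 ^ 2 * δ ^ 2) / 2 * i1 - v.2 ^ 2 / 2 * hδ2
      - (v.1 ^ 3 - 3 * v.1 * v.2 ^ 2 * δ ^ 2) / 6 * i2 + v.1 * v.2 ^ 2 / 2 * hδ2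
      + (3 * v.1 ^ 2 * v.2 * δ - v.2 ^ 3 * δ ^ 3) / 6 * i3

theorem frameEqs_comb {S : Set A3} {p : A3} {e : Fin 3 → A3} {f : Plane → ℝ} {ε : ℝ}
    (hf : ContDiffOn ℝ ∞ f (Metric.ball 0 ε))
    (hg : ∀ ξ : Fin 3 → ℝ, ‖ξ‖ < ε → (p + ∑ i, ξ i • e i ∈ S ↔ ξ 2 = f (ξ 0, ξ 1)))
    {x : A3} (hx : ‖x‖ < ε) (hxS : p + ∑ i, x i • e i ∈ S) {m : Fin 3 → A3}
    (hm : IsAdaptedFrame S (p + ∑ i, x i • e i) (comb e m)) :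
    FrameEqs (jet f (x 0, x 1)) m ∧ LinearIndependent ℝ m := by
  refine ⟨frameEqs_of_isAdaptedFrame hf hg hx ((hg x hx).1 hxS) hm, ?_⟩
  obtain ⟨_, ⟨h, _⟩, _⟩ := hm
  exact linearIndependent_of_comb h

/-- Adapted frames at a point are unique up to the symmetry group of the triangle. -/
theorem isAdaptedFrame_iff {S : Set A3} {p : A3} (hp : p ∈ S) {e e' : Fin 3 → A3}
    (h : IsAdaptedFrame S p e) : IsAdaptedFrame S p e' ↔ IsD3Related e e' := by
  refine ⟨fun h' => ?_, h.of_isD3Related⟩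
  obtain ⟨f, ⟨hind, ε, hε, hf, hg⟩, -⟩ := id h
  have hp0 : p = p + ∑ i, (0 : A3) i • e i := by simp
  obtain ⟨m, hm⟩ := exists_comb hind e
  obtain ⟨m', hm'⟩ := exists_comb hind e'
  rw [← hm, ← hm']
  have hx : ‖(0 : A3)‖ < ε := by simpa using hε
  rw [hp0] at hp
  obtain ⟨E, I⟩ := frameEqs_comb hf hg hx hp (m := m) (by rwa [hm, ← hp0])
  obtain ⟨E', I'⟩ := frameEqs_comb hf hg hx hp (m := m') (by rwa [hm', ← hp0])
  exact (E.isD3Related E' I I').comb e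

/-- In graph coordinates, a frame at a point of a regular elliptical surface which solves the frame
equations is adapted. -/
theorem isAdaptedFrame_of_frameEqs {S : Set A3} (hS : IsRegularElliptical S) {p : A3}
    {e : Fin 3 → A3} {f : Plane → ℝ} {ε : ℝ} (he : LinearIndependent ℝ e)
    (hf : ContDiffOn ℝ ∞ f (Metric.ball 0 ε))
    (hg : ∀ ξ : Fin 3 → ℝ, ‖ξ‖ < ε → (p + ∑ i, ξ i • e i ∈ S ↔ ξ 2 = f (ξ 0, ξ 1)))
    {x : A3} (hx : ‖x‖ < ε) (hxS : p + ∑ i, x i • e i ∈ S) {m : Fin 3 → A3}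
    (hm : FrameEqs (jet f (x 0, x 1)) m) (hi : LinearIndependent ℝ m) :
    IsAdaptedFrame S (p + ∑ i, x i • e i) (comb e m) := by
  -- No Taylor expansion in the given frame is needed. Some adapted frame exists at this point and
  -- solves the same equations, so the given frame differs from it by an element of D₃, which
  -- preserves adaptedness.
  obtain ⟨e', he'⟩ := hS _ hxS
  obtain ⟨m', rfl⟩ := exists_comb he e'
  obtain ⟨E', I'⟩ := frameEqs_comb hf hg hx hxS he'
  exact he'.of_isD3Related ((E'.isD3Related hm I' hi).comb e)

/-- `conormal J` isolates the coefficient of `m 2`; on the span of the other two vectors the Hessian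
is a nonzero multiple of the identity matrix and isolates theirs. -/
theorem FrameEqs.linearIndependent {J : ℕ → ℕ → ℝ} {m : Fin 3 → A3} (H : FrameEqs J m)
    (hκ : conormal J (m 2) ≠ 0) : LinearIndependent ℝ m := by
  rw [Fintype.linearIndependent_iff]
  intro g hg
  rw [Fin.sum_univ_three] at hg
  have hh : ∀ u v w : A3, ∀ a b : ℝ, hess J u (a • v + b • w) = a * hess J u v + b * hess J u w := by
    intro u v w a b
    simp only [hess, Pi.add_apply, Pi.smul_apply, smul_eq_mul]
    ring
  have hs : ∀ u v : A3, hess J u v = hess J v u := by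
    intro u v
    simp only [hess]
    ring
  have g2 : g 2 = 0 := by
    have := conormal_add_smul J (m 0) (m 1) (m 2) (g 0) (g 1) (g 2)
    rw [hg, H.tangent0, H.tangent1, show conormal J 0 = 0 by simp [conormal]] at this
    simpa [hκ] using this
  rw [g2, zero_smul, add_zero] at hg
  have g0 : g 0 = 0 := by
    have := hh (m 0) (m 0) (m 1) (g 0) (g 1)
    rw [hg, H.hess00, H.hess01] at this
    simpa [hess, hκ] using this
  have g1 : g 1 = 0 := by
    have := hh (m 1) (m 0) (m 1) (g 0) (g 1)
    rw [hg, H.hess11, hs (m 1) (m 0), H.hess01] at this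
    simpa [hess, hκ] using this
  intro i
  fin_cases i
  · exact g0
  · exact g1
  · exact g2

/-! ### An explicit solution of the frame equations. -/

/-- The tangent vector of the graph over the vector `(x, y)`. -/
def tangentLift (J : ℕ → ℕ → ℝ) (x y : ℝ) : A3 := ![x, y, J 1 0 * x + J 0 1 * y]

/-- A solution of the frame equations from an orthonormal basis `a, b` of the tangent plane, a
rotation `c, s` and a dilation `l` which normalize the apolar part of the cubic form. -/
theorem frameEqs_of_orthonormal {J : ℕ → ℕ → ℝ} {a b n : A3} {c s l α β μ ν : ℝ}
    (ta : conormal J a = 0) (tb : conormal J b = 0) (haa : hess J a a = 1) (hab : hess J a b = 0)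
    (hbb : hess J b b = 1) (hcs : c ^ 2 + s ^ 2 = 1)
    (hα : 4 * α = cub J a a a - 3 * cub J a b b) (hβ : 4 * β = cub J b b b - 3 * cub J a a b)
    (hμ : μ = cub J a a a + cub J a b b) (hν : ν = cub J a a b + cub J b b b)
    (h1 : l * (α * (c ^ 3 - 3 * c * s ^ 2) - β * (3 * c ^ 2 * s - s ^ 3)) = 1)
    (h2 : α * (3 * c ^ 2 * s - s ^ 3) + β * (c ^ 3 - 3 * c * s ^ 2) = 0)
    (tn : conormal J n = l ^ 2) (n0 : n 0 = -(l ^ 2 / 4) * (μ * a 0 + ν * b 0))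
    (n1 : n 1 = -(l ^ 2 / 4) * (μ * a 1 + ν * b 1)) :
    FrameEqs J ![l • (c • a + s • b), l • (-s • a + c • b), n] := by
  have han : hess J a n = -(l ^ 2 / 4) * μ := by
    simp only [hess] at haa hab ⊢
    rw [n0, n1]
    linear_combination -(l ^ 2 / 4) * (μ * haa + ν * hab)
  have hbn : hess J b n = -(l ^ 2 / 4) * ν := by
    simp only [hess] at hab hbb ⊢
    rw [n0, n1]
    linear_combination -(l ^ 2 / 4) * (μ * hab + ν * hbb)
  have hh : ∀ x y z w : ℝ, hess J (l • (x • a + y • b)) (l • (z • a + w • b))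
      = l ^ 2 * (x * z + y * w) := by
    intro x y z w
    simp only [hess, Pi.add_apply, Pi.smul_apply, smul_eq_mul] at haa hab hbb ⊢
    linear_combination l ^ 2 * (x * z * haa + (x * w + y * z) * hab + y * w * hbb)
  have hn : ∀ x y : ℝ, hess J (l • (x • a + y • b)) n = -(l ^ 3 / 4) * (x * μ + y * ν) := by
    intro x y
    simp only [hess, Pi.add_apply, Pi.smul_apply, smul_eq_mul] at han hbn ⊢
    linear_combination l * (x * han + y * hbn)
  have hc : ∀ x y z w u v : ℝ, cub J (l • (x • a + y • b)) (l • (z • a + w • b))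
      (l • (u • a + v • b)) = l ^ 3 * (x * z * u * cub J a a a
        + (x * z * v + x * w * u + y * z * u) * cub J a a b
        + (x * w * v + y * z * v + y * w * u) * cub J a b b + y * w * v * cub J b b b) := by
    intro x y z w u v
    simp only [cub, Pi.add_apply, Pi.smul_apply, smul_eq_mul]
    ring
  have ht : ∀ x y : ℝ, conormal J (l • (x • a + y • b)) = 0 := by
    intro x y
    simp only [conormal, Pi.add_apply, Pi.smul_apply, smul_eq_mul] at ta tb ⊢
    linear_combination l * (x * ta + y * tb)
  -- The cubic form splits into its apolar part `(α, β)` and its trace part `(μ, ν)`. The tangential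
  -- part of `n` is chosen so that its Hessian terms cancel the trace part; `h1` and `h2` normalize
  -- the apolar part.
  have ea : cub J a a a = α + 3 / 4 * μ := by linear_combination -hα / 4 - 3 / 4 * hμ
  have eb : cub J b b b = β + 3 / 4 * ν := by linear_combination -hβ / 4 - 3 / 4 * hν
  have eab : cub J a a b = -β + ν / 4 := by linear_combination hβ / 4 - hν / 4
  have eba : cub J a b b = -α + μ / 4 := by linear_combination hα / 4 - hμ / 4
  constructor <;> simp only [Matrix.cons_val]
  · exact ht _ _
  · exact ht _ _
  · rw [hh, tn]; linear_combination l ^ 2 * hcs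
  · rw [hh]; ring
  · rw [hh, tn]; linear_combination l ^ 2 * hcs
  · rw [hc, hn, tn, ea, eb, eab, eba]
    linear_combination l ^ 2 * h1 + 3 / 4 * l ^ 3 * (c * μ + s * ν) * hcs
  · rw [hc, hn, ea, eb, eab, eba]
    linear_combination -l ^ 3 * h2 + l ^ 3 / 4 * (c * ν - s * μ) * hcs
  · rw [hc, hn, tn, ea, eb, eab, eba]
    linear_combination -l ^ 2 * h1 + l ^ 3 / 4 * (c * μ + s * ν) * hcs
  · rw [hc, hn, ea, eb, eab, eba]
    linear_combination l ^ 3 * h2 + 3 / 4 * l ^ 3 * (c * ν - s * μ) * hcs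

/-- The first vector of the Gram-Schmidt basis of the tangent plane. -/
noncomputable def gram1 (J : ℕ → ℕ → ℝ) : A3 := tangentLift J (√(J 2 0))⁻¹ 0

/-- The second vector of the Gram-Schmidt basis of the tangent plane. -/
noncomputable def gram2 (J : ℕ → ℕ → ℝ) : A3 :=
  tangentLift J (-J 1 1 * (√(J 2 0))⁻¹ * (√(J 2 0 * J 0 2 - J 1 1 ^ 2))⁻¹)
    (J 2 0 * (√(J 2 0))⁻¹ * (√(J 2 0 * J 0 2 - J 1 1 ^ 2))⁻¹)

/-- The real part of the apolar cubic form. -/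
noncomputable def apolarRe (J : ℕ → ℕ → ℝ) : ℝ :=
  (cub J (gram1 J) (gram1 J) (gram1 J) - 3 * cub J (gram1 J) (gram2 J) (gram2 J)) / 4

/-- The imaginary part of the apolar cubic form. -/
noncomputable def apolarIm (J : ℕ → ℕ → ℝ) : ℝ :=
  (cub J (gram2 J) (gram2 J) (gram2 J) - 3 * cub J (gram1 J) (gram1 J) (gram2 J)) / 4

/-- The angle of the rotation which normalizes the apolar cubic form. -/
noncomputable def angle (J : ℕ → ℕ → ℝ) : ℝ := -(Real.arctan (apolarIm J / apolarRe J) / 3)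

/-- The factor of the dilation which normalizes the apolar cubic form. -/
noncomputable def dilation (J : ℕ → ℕ → ℝ) : ℝ := (√(apolarRe J ^ 2 + apolarIm J ^ 2))⁻¹

/-- The tangential coordinates of the affine normal vector. -/
noncomputable def normalCoord (J : ℕ → ℕ → ℝ) (i : Fin 3) : ℝ :=
  -(dilation J ^ 2 / 4) *
    ((cub J (gram1 J) (gram1 J) (gram1 J) + cub J (gram1 J) (gram2 J) (gram2 J)) * gram1 J i
    + (cub J (gram1 J) (gram1 J) (gram2 J) + cub J (gram2 J) (gram2 J) (gram2 J)) * gram2 J i)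

/-- A solution of the frame equations. -/
noncomputable def frameSol (J : ℕ → ℕ → ℝ) : Fin 3 → A3 :=
  ![dilation J • (Real.cos (angle J) • gram1 J + Real.sin (angle J) • gram2 J),
    dilation J • (-Real.sin (angle J) • gram1 J + Real.cos (angle J) • gram2 J),
    ![normalCoord J 0, normalCoord J 1,
      dilation J ^ 2 + J 1 0 * normalCoord J 0 + J 0 1 * normalCoord J 1]]

theorem conormal_tangentLift (J : ℕ → ℕ → ℝ) (x y : ℝ) : conormal J (tangentLift J x y) = 0 := by
  simp only [conormal, tangentLift, Matrix.cons_val]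
  ring

theorem frameSol_frameEqs {J : ℕ → ℕ → ℝ} (h1 : 0 < J 2 0)
    (h2 : 0 < J 2 0 * J 0 2 - J 1 1 ^ 2) (h3 : 0 < apolarRe J) :
    FrameEqs J (frameSol J) ∧ LinearIndependent ℝ (frameSol J) := by
  have hA : (√(J 2 0)) ^ 2 = J 2 0 := Real.sq_sqrt h1.le
  have hD : (√(J 2 0 * J 0 2 - J 1 1 ^ 2)) ^ 2 = J 2 0 * J 0 2 - J 1 1 ^ 2 := Real.sq_sqrt h2.le
  have hA0 : √(J 2 0) ≠ 0 := (Real.sqrt_pos.2 h1).ne'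
  have hD0 : √(J 2 0 * J 0 2 - J 1 1 ^ 2) ≠ 0 := (Real.sqrt_pos.2 h2).ne'
  have hr : 0 < √(apolarRe J ^ 2 + apolarIm J ^ 2) := Real.sqrt_pos.2 (by positivity)
  have hr2 : (√(apolarRe J ^ 2 + apolarIm J ^ 2)) ^ 2 = apolarRe J ^ 2 + apolarIm J ^ 2 :=
    Real.sq_sqrt (by positivity)
  -- A rotation by θ acts on the apolar part through 3θ. As `apolarRe J` is positive, the arctangent
  -- is the argument of `apolarRe J` + i `apolarIm J`, so rotating by minus a third of it makes the
  -- apolar part real and positive.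
  have h3θ : 3 * angle J = -Real.arctan (apolarIm J / apolarRe J) := by rw [angle]; ring
  have hq : √(1 + (apolarIm J / apolarRe J) ^ 2)
      = √(apolarRe J ^ 2 + apolarIm J ^ 2) / apolarRe J := by
    rw [show 1 + (apolarIm J / apolarRe J) ^ 2
      = (apolarRe J ^ 2 + apolarIm J ^ 2) / apolarRe J ^ 2 by field_simp,
      Real.sqrt_div (by positivity), Real.sqrt_sq h3.le]
  have hcos : Real.cos (3 * angle J) = apolarRe J / √(apolarRe J ^ 2 + apolarIm J ^ 2) := by
    rw [h3θ, Real.cos_neg, Real.cos_arctan, hq]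
    field_simp
  have hsin : Real.sin (3 * angle J) = -apolarIm J / √(apolarRe J ^ 2 + apolarIm J ^ 2) := by
    rw [h3θ, Real.sin_neg, Real.sin_arctan, hq]
    field_simp
  have hcs := Real.cos_sq_add_sin_sq (angle J)
  have hc3 : Real.cos (angle J) ^ 3 - 3 * Real.cos (angle J) * Real.sin (angle J) ^ 2
      = apolarRe J / √(apolarRe J ^ 2 + apolarIm J ^ 2) := by
    rw [← hcos, Real.cos_three_mul]
    linear_combination -3 * Real.cos (angle J) * hcs
  have hs3 : 3 * Real.cos (angle J) ^ 2 * Real.sin (angle J) - Real.sin (angle J) ^ 3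
      = -apolarIm J / √(apolarRe J ^ 2 + apolarIm J ^ 2) := by
    rw [← hsin, Real.sin_three_mul]
    linear_combination 3 * Real.sin (angle J) * hcs
  have hE : FrameEqs J (frameSol J) := by
    refine frameEqs_of_orthonormal (conormal_tangentLift _ _ _) (conormal_tangentLift _ _ _)
      (α := apolarRe J) (β := apolarIm J)
      ?_ ?_ ?_ hcs (by rw [apolarRe]; ring) (by rw [apolarIm]; ring) rfl rfl ?_ ?_ ?_ rfl rfl
    · simp only [gram1, tangentLift, hess, Matrix.cons_val]
      field_simp
      linear_combination -hA
    · simp only [gram1, gram2, tangentLift, hess, Matrix.cons_val]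
      ring
    · simp only [gram2, tangentLift, hess, Matrix.cons_val]
      field_simp
      rw [hA, hD]
      ring
    · rw [hc3, hs3, dilation]
      field_simp
      linear_combination -hr2
    · rw [hc3, hs3]
      ring
    · simp only [conormal, Matrix.cons_val]
      ring
  refine ⟨hE, hE.linearIndependent ?_⟩
  have : conormal J (frameSol J 2) = dilation J ^ 2 := by
    simp only [conormal, frameSol, Matrix.cons_val]
    ring
  rw [this]
  exact pow_ne_zero 2 (inv_ne_zero hr.ne')

/-! ### Smooth dependence of the explicit solution on the base point. -/

section Smooth

variable {f : Plane → ℝ} {u : Plane}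

theorem contDiffAt_gram1 (hf : ContDiffAt ℝ ∞ f u) (h1 : 0 < jet f u 2 0) (i : Fin 3) :
    ContDiffAt ℝ ∞ (fun u => gram1 (jet f u) i) u := by
  have j := contDiffAt_jet hf
  have a : ContDiffAt ℝ ∞ (fun u => (√(jet f u 2 0))⁻¹) u :=
    ((j 2 0).sqrt h1.ne').inv (Real.sqrt_pos.2 h1).ne'
  have j10 := j 1 0
  have j01 := j 0 1
  fin_cases i <;> simp only [gram1, tangentLift, Fin.zero_eta, Fin.mk_one, Fin.reduceFinMk,
    Matrix.cons_val] <;> fun_prop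

theorem contDiffAt_gram2 (hf : ContDiffAt ℝ ∞ f u) (h1 : 0 < jet f u 2 0)
    (h2 : 0 < jet f u 2 0 * jet f u 0 2 - jet f u 1 1 ^ 2) (i : Fin 3) :
    ContDiffAt ℝ ∞ (fun u => gram2 (jet f u) i) u := by
  have j := contDiffAt_jet hf
  have a : ContDiffAt ℝ ∞ (fun u => (√(jet f u 2 0))⁻¹) u :=
    ((j 2 0).sqrt h1.ne').inv (Real.sqrt_pos.2 h1).ne'
  have j10 := j 1 0
  have j01 := j 0 1
  have j20 := j 2 0
  have j11 := j 1 1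
  have j02 := j 0 2
  have d : ContDiffAt ℝ ∞
      (fun u => (√(jet f u 2 0 * jet f u 0 2 - jet f u 1 1 ^ 2))⁻¹) u := by
    have : ContDiffAt ℝ ∞ (fun u => jet f u 2 0 * jet f u 0 2 - jet f u 1 1 ^ 2) u := by fun_prop
    exact (this.sqrt h2.ne').inv (Real.sqrt_pos.2 h2).ne'
  fin_cases i <;> simp only [gram2, tangentLift, Fin.zero_eta, Fin.mk_one, Fin.reduceFinMk,
    Matrix.cons_val] <;> fun_prop

theorem contDiffAt_cub (hf : ContDiffAt ℝ ∞ f u) {a b c : Plane → A3}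
    (ha : ∀ i, ContDiffAt ℝ ∞ (fun u => a u i) u) (hb : ∀ i, ContDiffAt ℝ ∞ (fun u => b u i) u)
    (hc : ∀ i, ContDiffAt ℝ ∞ (fun u => c u i) u) :
    ContDiffAt ℝ ∞ (fun u => cub (jet f u) (a u) (b u) (c u)) u := by
  have j := contDiffAt_jet hf
  have j30 := j 3 0
  have j21 := j 2 1
  have j12 := j 1 2
  have j03 := j 0 3
  have a0 := ha 0
  have a1 := ha 1
  have b0 := hb 0
  have b1 := hb 1
  have c0 := hc 0
  have c1 := hc 1
  unfold cub
  fun_prop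

theorem contDiffAt_apolarRe (hf : ContDiffAt ℝ ∞ f u) (h1 : 0 < jet f u 2 0)
    (h2 : 0 < jet f u 2 0 * jet f u 0 2 - jet f u 1 1 ^ 2) :
    ContDiffAt ℝ ∞ (fun u => apolarRe (jet f u)) u := by
  have a := contDiffAt_gram1 hf h1
  have b := contDiffAt_gram2 hf h1 h2
  have c1 := contDiffAt_cub hf a a a
  have c2 := contDiffAt_cub hf a b b
  unfold apolarRe
  fun_prop

theorem contDiffAt_frameSol (hf : ContDiffAt ℝ ∞ f u) (h1 : 0 < jet f u 2 0)
    (h2 : 0 < jet f u 2 0 * jet f u 0 2 - jet f u 1 1 ^ 2) (h3 : 0 < apolarRe (jet f u)) :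
    ContDiffAt ℝ ∞ (fun u => frameSol (jet f u)) u := by
  have a := contDiffAt_gram1 hf h1
  have b := contDiffAt_gram2 hf h1 h2
  have c1 := contDiffAt_cub hf a a a
  have c2 := contDiffAt_cub hf a b b
  have c3 := contDiffAt_cub hf a a b
  have c4 := contDiffAt_cub hf b b b
  have hα := contDiffAt_apolarRe hf h1 h2
  have hβ : ContDiffAt ℝ ∞ (fun u => apolarIm (jet f u)) u := by
    unfold apolarIm
    fun_prop
  have hr : 0 < apolarRe (jet f u) ^ 2 + apolarIm (jet f u) ^ 2 := by positivity
  have hl : ContDiffAt ℝ ∞ (fun u => dilation (jet f u)) u := by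
    have : ContDiffAt ℝ ∞ (fun u => apolarRe (jet f u) ^ 2 + apolarIm (jet f u) ^ 2) u := by
      fun_prop
    exact (this.sqrt hr.ne').inv (Real.sqrt_pos.2 hr).ne'
  have hθ : ContDiffAt ℝ ∞ (fun u => angle (jet f u)) u :=
    ((Real.contDiff_arctan.contDiffAt.comp u (hβ.div hα h3.ne')).div_const 3).neg
  have hc : ContDiffAt ℝ ∞ (fun u => Real.cos (angle (jet f u))) u := hθ.cos
  have hs : ContDiffAt ℝ ∞ (fun u => Real.sin (angle (jet f u))) u := hθ.sin
  have hn : ∀ i, ContDiffAt ℝ ∞ (fun u => normalCoord (jet f u) i) u := by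
    intro i
    have ai := a i
    have bi := b i
    unfold normalCoord
    fun_prop
  have n0 := hn 0
  have n1 := hn 1
  have j10 := contDiffAt_jet hf 1 0
  have j01 := contDiffAt_jet hf 0 1
  rw [contDiffAt_pi]
  intro k
  rw [contDiffAt_pi]
  intro i
  have ai := a i
  have bi := b i
  fin_cases k
  · simp only [frameSol, Fin.zero_eta, Matrix.cons_val, Pi.add_apply, Pi.smul_apply, smul_eq_mul]
    fun_prop
  · simp only [frameSol, Fin.mk_one, Matrix.cons_val, Pi.add_apply, Pi.smul_apply, smul_eq_mul]
    fun_prop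
  · clear ai bi
    fin_cases i <;> simp only [frameSol, Fin.zero_eta, Fin.mk_one, Fin.reduceFinMk,
      Matrix.cons_val] <;> fun_prop

end Smooth

/-! ### Coordinate forms of a frame. -/

theorem isUnit_of_linearIndependent {e : Fin 3 → A3} (he : LinearIndependent ℝ e) :
    IsUnit ((Matrix.of e).transpose).det := by
  rw [Matrix.det_transpose, ← Matrix.isUnit_iff_isUnit_det]
  exact Matrix.linearIndependent_rows_iff_isUnit.1 he

theorem coordForm_apply (e : Fin 3 → A3) (i : Fin 3) (v : A3) :
    coordForm e i v = (((Matrix.of e).transpose)⁻¹.mulVec v) i := rfl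

theorem sum_smul_eq_mulVec (e : Fin 3 → A3) (ξ : A3) :
    ∑ i, ξ i • e i = (Matrix.of e).transpose.mulVec ξ := by
  ext k
  simp only [Finset.sum_apply, Pi.smul_apply, smul_eq_mul, Matrix.mulVec, dotProduct,
    Matrix.transpose_apply, Matrix.of_apply]
  exact Finset.sum_congr rfl fun j _ => mul_comm _ _

theorem coordForm_sum {e : Fin 3 → A3} (he : LinearIndependent ℝ e) (ξ : A3) (i : Fin 3) :
    coordForm e i (∑ j, ξ j • e j) = ξ i := by
  rw [coordForm_apply, sum_smul_eq_mulVec, Matrix.mulVec_mulVec,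
    Matrix.nonsing_inv_mul _ (isUnit_of_linearIndependent he), Matrix.one_mulVec]

theorem sum_coordForm {e : Fin 3 → A3} (he : LinearIndependent ℝ e) (v : A3) :
    ∑ i, coordForm e i v • e i = v := by
  have := sum_smul_eq_mulVec e (fun i => coordForm e i v)
  rw [this]
  change (Matrix.of e).transpose.mulVec (((Matrix.of e).transpose)⁻¹.mulVec v) = v
  rw [Matrix.mulVec_mulVec,
    Matrix.mul_nonsing_inv _ (isUnit_of_linearIndependent he), Matrix.one_mulVec]

theorem coordForm_self {e : Fin 3 → A3} (he : LinearIndependent ℝ e) (i j : Fin 3) :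
    coordForm e i (e j) = if j = i then 1 else 0 := by
  have := coordForm_sum he (Pi.single j 1) i
  simpa [Pi.single_apply, Finset.sum_ite_eq, eq_comm] using this

/-- Cramer's rule: the coordinate forms are the adjugate divided by a nonvanishing determinant. -/
theorem contDiffAt_coordForm {n : WithTop ℕ∞} {E : Plane → Fin 3 → A3} {u : Plane}
    (hE : ContDiffAt ℝ n E u) (he : LinearIndependent ℝ (E u)) (i : Fin 3) :
    ContDiffAt ℝ n (fun s => coordForm (E s) i) u := by
  have hij : ∀ j k, ContDiffAt ℝ n (fun s => E s j k) u := fun j k =>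
    contDiffAt_pi.1 (contDiffAt_pi.1 hE j) k
  have h1 : (fun s => coordForm (E s) i) = fun s => ∑ j,
      ((((Matrix.of (E s)).transpose).det)⁻¹ * ((Matrix.of (E s)).transpose).adjugate i j) •
        (ContinuousLinearMap.proj j : A3 →L[ℝ] ℝ) := by
    ext s v
    simp only [coordForm_apply, Matrix.mulVec, dotProduct, Matrix.inv_def, Matrix.smul_apply,
      Ring.inverse_eq_inv', smul_eq_mul, _root_.sum_apply, _root_.smul_apply,
      ContinuousLinearMap.proj_apply]
  have hd : ContDiffAt ℝ n (fun s => (((Matrix.of (E s)).transpose).det)⁻¹) u := by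
    refine ContDiffAt.inv ?_ (isUnit_of_linearIndependent he).ne_zero
    simp only [Matrix.det_fin_three, Matrix.transpose_apply, Matrix.of_apply]
    fun_prop
  have ha : ∀ j, ContDiffAt ℝ n (fun s => ((Matrix.of (E s)).transpose).adjugate i j) u := by
    intro j
    simp only [Matrix.adjugate_fin_three, Matrix.transpose_apply, Matrix.of_apply]
    fin_cases i <;> fin_cases j <;>
      simp only [Fin.zero_eta, Fin.mk_one, Fin.reduceFinMk, Matrix.cons_val] <;>
      fun_prop
  rw [h1]
  exact ContDiffAt.sum fun j _ => (hd.mul (ha j)).smul contDiffAt_const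

/-! ### Moving frames exist -/

theorem IsAdaptedFrame.linearIndependent {S : Set A3} {p : A3} {e : Fin 3 → A3}
    (h : IsAdaptedFrame S p e) : LinearIndependent ℝ e := by
  obtain ⟨_, ⟨h, _⟩, _⟩ := h
  exact h

theorem sum_coordForm_sub {e : Fin 3 → A3} (he : LinearIndependent ℝ e) (p q : A3) :
    p + ∑ i, (fun i => coordForm e i (q - p)) i • e i = q := by
  rw [sum_coordForm he]
  abel

/-- In graph coordinates of one adapted frame at `p`, the positivity conditions of
`frameSol_frameEqs` hold at the origin and therefore nearby. The explicit solution in these fixed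
coordinates is the moving frame. -/
theorem exists_isMovingFrame {S : Set A3} (hS : IsRegularElliptical S) {p : A3} (hp : p ∈ S) :
    ∃ (N : Set A3) (e : A3 → Fin 3 → A3) (I : A3 → Curvatures), p ∈ N ∧ IsMovingFrame S N e I := by
  obtain ⟨e, f, ⟨he, ε, hε, hf, hg⟩, ho⟩ := hS p hp
  have hf0 : ContDiffAt ℝ ∞ f 0 := hf.contDiffAt (Metric.ball_mem_nhds _ hε)
  have hJ := jet_of_adapted hf0 ho ⟨0, 0, 0, 0, 0⟩
  have j20 : jet f 0 2 0 = 1 := hJ 2 0 (by norm_num)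
  have j11 : jet f 0 1 1 = 0 := hJ 1 1 (by norm_num)
  have j02 : jet f 0 0 2 = 1 := hJ 0 2 (by norm_num)
  have j30 : jet f 0 3 0 = 1 := hJ 3 0 (by norm_num)
  have j21 : jet f 0 2 1 = 0 := hJ 2 1 (by norm_num)
  have j12 : jet f 0 1 2 = -1 := hJ 1 2 (by norm_num)
  have j03 : jet f 0 0 3 = 0 := hJ 0 3 (by norm_num)
  have j10 : jet f 0 1 0 = 0 := hJ 1 0 (by norm_num)
  have j01 : jet f 0 0 1 = 0 := hJ 0 1 (by norm_num)
  have p1 : 0 < jet f 0 2 0 := by rw [j20]; norm_num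
  have p2 : 0 < jet f 0 2 0 * jet f 0 0 2 - jet f 0 1 1 ^ 2 := by
    rw [j20, j02, j11]; norm_num
  -- At the origin the cubic is already standard, and `apolarRe` equals 1.
  have p3 : 0 < apolarRe (jet f 0) := by
    simp [apolarRe, cub, gram1, gram2, tangentLift, j20, j11, j02, j30, j12, j21, j03]
    norm_num
  have c20 := contDiffAt_jet hf0 2 0
  have c02 := contDiffAt_jet hf0 0 2
  have c11 := contDiffAt_jet hf0 1 1
  have cD : ContDiffAt ℝ ∞ (fun u => jet f u 2 0 * jet f u 0 2 - jet f u 1 1 ^ 2) 0 := by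
    fun_prop
  have ev : ∀ᶠ u in 𝓝 (0 : Plane), u ∈ Metric.ball (0 : Plane) ε ∧ 0 < jet f u 2 0 ∧
      0 < jet f u 2 0 * jet f u 0 2 - jet f u 1 1 ^ 2 ∧ 0 < apolarRe (jet f u) :=
    (Metric.isOpen_ball.eventually_mem (Metric.mem_ball_self hε)).and
      ((c20.continuousAt.eventually_const_lt p1).and
      ((cD.continuousAt.eventually_const_lt p2).and
      ((contDiffAt_apolarRe hf0 p1 p2).continuousAt.eventually_const_lt p3)))
  obtain ⟨V, hV, hVo, hV0⟩ := eventually_nhds_iff.1 ev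
  let x : A3 → A3 := fun q i => coordForm e i (q - p)
  have hxc : ContDiff ℝ ∞ x := contDiff_pi.2 fun i => by fun_prop
  have hx0 : x p = 0 := by ext i; simp [x]
  let π : A3 → Plane := fun q => (x q 0, x q 1)
  have hπc : ContDiff ℝ ∞ π := by
    have h0 : ContDiff ℝ ∞ fun q => x q 0 := contDiff_pi.1 hxc 0
    have h1 : ContDiff ℝ ∞ fun q => x q 1 := contDiff_pi.1 hxc 1
    exact h0.prodMk h1
  let N : Set A3 := x ⁻¹' Metric.ball 0 ε ∩ π ⁻¹' V
  have hN : IsOpen N :=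
    (Metric.isOpen_ball.preimage hxc.continuous).inter (hVo.preimage hπc.continuous)
  have had : ∀ q ∈ S ∩ N, IsAdaptedFrame S q (comb e (frameSol (jet f (π q)))) := by
    rintro q ⟨hqS, hqx, hqV⟩
    obtain ⟨_, q1, q2, q3⟩ := hV _ hqV
    obtain ⟨E, I⟩ := frameSol_frameEqs q1 q2 q3
    have hq := sum_coordForm_sub he p q
    have := isAdaptedFrame_of_frameEqs hS he hf hg (x := x q) (by simpa using hqx)
      (by rw [hq]; exact hqS) E I
    rwa [hq] at this
  -- Off `S ∩ N` the curvatures get a dummy value, and on it they are chosen pointwise;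
  -- `IsMovingFrame` asks for smoothness of the frame only.
  refine ⟨N, fun q => comb e (frameSol (jet f (π q))),
    fun q => open Classical in if h : q ∈ S ∩ N then (had q h).exists_hasCurvatures.choose
      else ⟨0, 0, 0, 0, 0⟩, ⟨?_, ?_⟩, hN, ?_, ?_⟩
  · simpa [hx0] using hε
  · change π p ∈ V
    have : π p = 0 := by simp [π, hx0]
    rwa [this]
  · rintro q ⟨-, -, hqV⟩
    obtain ⟨q0, q1, q2, q3⟩ := hV _ hqV
    have h1 := contDiffAt_frameSol (hf.contDiffAt (Metric.isOpen_ball.mem_nhds q0)) q1 q2 q3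
    have h2 : ContDiffAt ℝ ∞ (fun q => frameSol (jet f (π q))) q :=
      h1.comp (f := π) q hπc.contDiffAt
    refine ContDiffAt.contDiffWithinAt ?_
    refine contDiffAt_pi.2 fun j => ?_
    refine ContDiffAt.sum fun i _ => ?_
    exact (contDiffAt_pi.1 (contDiffAt_pi.1 h2 j) i).smul contDiffAt_const
  · intro q hq
    simp only [dif_pos hq]
    exact (had q hq).exists_hasCurvatures.choose_spec

/-! ### Affine invariance -/

theorem IsLocalGraph.image {S : Set A3} {p : A3} {e : Fin 3 → A3} {f : Plane → ℝ}
    (h : IsLocalGraph S p e f) (T : A3 ≃ᵃ[ℝ] A3) :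
    IsLocalGraph (T '' S) (T p) (fun i => T.linear (e i)) f := by
  obtain ⟨hi, ε, hε, hf, hg⟩ := h
  refine ⟨?_, ε, hε, hf, fun ξ hξ => ?_⟩
  · exact hi.map' T.linear.toLinearMap (LinearMap.ker_eq_bot.2 T.linear.injective)
  · rw [← hg ξ hξ]
    have : T p + ∑ i, ξ i • T.linear (e i) = T (p + ∑ i, ξ i • e i) := by
      have := T.map_vadd p (∑ i, ξ i • e i)
      rw [vadd_eq_add, vadd_eq_add, add_comm (∑ i, ξ i • e i), map_sum] at this
      rw [this, add_comm]
      simp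
    rw [this, T.injective.mem_set_image]

theorem IsRegularElliptical.image {S : Set A3} (hS : IsRegularElliptical S) (T : A3 ≃ᵃ[ℝ] A3) :
    IsRegularElliptical (T '' S) := by
  rintro _ ⟨p, hp, rfl⟩
  obtain ⟨e, f, hf, ho⟩ := hS p hp
  exact ⟨_, f, hf.image T, ho⟩

theorem contDiff_affineEquiv (T : A3 ≃ᵃ[ℝ] A3) : ContDiff ℝ ∞ T := by
  have : (T : A3 → A3) = fun q => T.linear.toLinearMap.toContinuousLinearMap q + T 0 := by
    ext1 q
    have := T.map_vadd 0 q
    simpa using this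
  rw [this]
  fun_prop

theorem contDiff_linear (T : A3 ≃ᵃ[ℝ] A3) : ContDiff ℝ ∞ T.linear := by
  have : (T.linear : A3 → A3) = fun q => T.linear.toLinearMap.toContinuousLinearMap q := by
    ext1 q
    rfl
  rw [this]
  fun_prop

theorem IsMovingFrame.image {S N : Set A3} {e : A3 → Fin 3 → A3} {I : A3 → Curvatures}
    (h : IsMovingFrame S N e I) (T : A3 ≃ᵃ[ℝ] A3) :
    IsMovingFrame (T '' S) (T '' N) (fun q i => T.linear (e (T.symm q) i))
      (fun q => I (T.symm q)) := by
  have hm : MapsTo T.symm (T '' S ∩ T '' N) (S ∩ N) := by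
    rintro _ ⟨⟨q, hq, rfl⟩, ⟨q', hq', h⟩⟩
    obtain rfl := T.injective h
    simpa using ⟨hq, hq'⟩
  refine ⟨?_, ?_, ?_⟩
  · have : T '' N = T.symm ⁻¹' N := T.toEquiv.image_eq_preimage_symm N
    rw [this]
    exact h.isOpen.preimage (contDiff_affineEquiv T.symm).continuous
  · have h1 := h.smooth.comp (contDiff_affineEquiv T.symm).contDiffOn hm
    refine contDiffOn_pi.2 fun i => ?_
    exact (contDiff_linear T).comp_contDiffOn (contDiffOn_pi.1 h1 i)
  · intro q hq
    obtain ⟨f, hf, ho⟩ := h.adapted _ (hm hq)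
    refine ⟨f, ?_, ho⟩
    have := hf.image T
    simpa using this

theorem coordForm_image (T : A3 ≃ᵃ[ℝ] A3) {e : Fin 3 → A3} (he : LinearIndependent ℝ e)
    (i : Fin 3) (v : A3) :
    coordForm (fun j => T.linear (e j)) i (T.linear v) = coordForm e i v := by
  have hi : LinearIndependent ℝ (fun j => T.linear (e j)) :=
    he.map' T.linear.toLinearMap (LinearMap.ker_eq_bot.2 T.linear.injective)
  conv_lhs => rw [← sum_coordForm he v]
  rw [map_sum]
  simp only [map_smul]
  have := coordForm_sum hi (fun j => coordForm e j v) i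
  simpa using this

theorem coframe_image {S N : Set A3} {e : A3 → Fin 3 → A3} {I : A3 → Curvatures}
    (h : IsMovingFrame S N e I) (T : A3 ≃ᵃ[ℝ] A3) {U : Set Plane} {X : Plane → A3}
    (hX : IsPatch (S ∩ N) U X) {u : Plane} (hu : u ∈ U) (i : Fin 3) :
    coframe (fun q j => T.linear (e (T.symm q) j)) (T ∘ X) i u = coframe e X i u := by
  have hd : DifferentiableAt ℝ X u :=
    ((hX.smooth.contDiffAt (hX.isOpen.mem_nhds hu))).differentiableAt (by simp)
  have hT : HasFDerivAt T (T.linear.toLinearMap.toContinuousLinearMap) (X u) := by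
    have : (T : A3 → A3) = fun q => T.linear.toLinearMap.toContinuousLinearMap q + T 0 := by
      ext1 q
      have := T.map_vadd 0 q
      simpa using this
    rw [this]
    exact (ContinuousLinearMap.hasFDerivAt _).add_const _
  have h1 := (hT.comp u hd.hasFDerivAt).fderiv
  refine ContinuousLinearMap.ext fun v => ?_
  rw [coframe, coframe, h1]
  have he := (h.adapted _ (hX.mapsTo hu)).isAdaptedFrame.linearIndependent
  simpa using coordForm_image T he i (fderiv ℝ X u v)

/-! ### Differentiating the frame equations. -/

section Derivatives

variable {A : ℝ → ℕ → ℕ → ℝ} {A' : ℕ → ℕ → ℝ} {u v w : ℝ → A3} {u' v' w' : A3} {t : ℝ}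

theorem hasDerivAt_conormal (hA : ∀ k l, HasDerivAt (fun t => A t k l) (A' k l) t)
    (hu : ∀ i, HasDerivAt (fun t => u t i) (u' i) t) :
    HasDerivAt (fun t => conormal (A t) (u t))
      (conormal (A t) u' - A' 1 0 * u t 0 - A' 0 1 * u t 1) t := by
  refine (((hu 2).sub ((hA 1 0).mul (hu 0))).sub ((hA 0 1).mul (hu 1))).congr_deriv ?_
  simp only [conormal]
  ring

theorem hasDerivAt_hess (hA : ∀ k l, HasDerivAt (fun t => A t k l) (A' k l) t)
    (hu : ∀ i, HasDerivAt (fun t => u t i) (u' i) t)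
    (hv : ∀ i, HasDerivAt (fun t => v t i) (v' i) t) :
    HasDerivAt (fun t => hess (A t) (u t) (v t))
      (hess A' (u t) (v t) + hess (A t) u' (v t) + hess (A t) (u t) v') t := by
  have h := fun i j => (hu i).mul (hv j)
  refine ((((hA 2 0).mul (h 0 0)).add ((hA 1 1).mul ((h 0 1).add (h 1 0)))).add
    ((hA 0 2).mul (h 1 1))).congr_deriv ?_
  simp only [hess, Pi.mul_apply, Pi.add_apply]
  ring

theorem hasDerivAt_cub (hA : ∀ k l, HasDerivAt (fun t => A t k l) (A' k l) t)
    (hu : ∀ i, HasDerivAt (fun t => u t i) (u' i) t)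
    (hv : ∀ i, HasDerivAt (fun t => v t i) (v' i) t)
    (hw : ∀ i, HasDerivAt (fun t => w t i) (w' i) t) :
    HasDerivAt (fun t => cub (A t) (u t) (v t) (w t))
      (cub A' (u t) (v t) (w t) + cub (A t) u' (v t) (w t) + cub (A t) (u t) v' (w t)
        + cub (A t) (u t) (v t) w') t := by
  have h := fun i j k => ((hu i).mul (hv j)).mul (hw k)
  refine (((((hA 3 0).mul (h 0 0 0)).add ((hA 2 1).mul (((h 0 0 1).add (h 0 1 0)).add
    (h 1 0 0)))).add ((hA 1 2).mul (((h 0 1 1).add (h 1 0 1)).add (h 1 1 0)))).add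
    ((hA 0 3).mul (h 1 1 1))).congr_deriv ?_
  simp only [cub, Pi.mul_apply, Pi.add_apply]
  ring

end Derivatives

theorem derivative_eq_of_eventuallyEq {F G : ℝ → ℝ} {a b t : ℝ} (hF : HasDerivAt F a t)
    (hG : HasDerivAt G b t) (h : ∀ᶠ s in 𝓝 t, F s = G s) : a = b :=
  (hF.congr_of_eventuallyEq (EventuallyEq.symm h)).unique hG

/-- The connection form of a moving frame, expressed by the curvatures and by the values `a, b` of
the invariant coframe: the `i`-th coordinate of the derivative of the `j`-th vector. -/
noncomputable def conn (I : Curvatures) (a b : ℝ) : Fin 3 → Fin 3 → ℝ :=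
  let q₁ := a * I.i40 + b * I.i31
  let q₂ := a * I.i31 + b * I.i22
  let q₃ := a * I.i22 + b * I.i13
  let q₄ := a * I.i13 + b * I.i04
  let k := (3 * q₃ - q₁) / 2
  let r := b / 2 - q₂ / 4 + q₄ / 12
  ![![k / 2 - a / 2, b - r, a], ![r, k / 2 + a / 2, b],
    ![k / 2 + a / 2 - q₃, r - q₄ / 3, k]]

/-- At `t = 0` the frame is the identity and the 3-jet is standard, so the nine differentiated
equations are a linear system with constant coefficients for the nine entries of `M'`, solved
uniquely by `conn`. The curvatures enter through the derivatives of the third-order partials. -/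
theorem derivative_of_frameEqs {A : ℝ → ℕ → ℕ → ℝ} {A' : ℕ → ℕ → ℝ} {M : ℝ → Fin 3 → A3}
    {M' : Fin 3 → A3} {I : Curvatures} {a b : ℝ}
    (hA : ∀ k l, HasDerivAt (fun t => A t k l) (A' k l) 0)
    (hM : ∀ j i, HasDerivAt (fun t => M t j i) (M' j i) 0)
    (hA0 : ∀ k l, k + l ≤ 3 → A 0 k l = stdJet I k l)
    (hA' : ∀ k l, k + l ≤ 3 → A' k l = stdJet I (k + 1) l * a + stdJet I k (l + 1) * b)
    (hM0 : ∀ j i, M 0 j i = if j = i then 1 else 0)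
    (hE : ∀ᶠ t in 𝓝 0, FrameEqs (A t) (M t)) : M' = conn I a b := by
  have cn := fun j => hasDerivAt_conormal hA (hM j)
  have hs := fun j k => hasDerivAt_hess hA (hM j) (hM k)
  have cb := fun i j k => hasDerivAt_cub hA (hM i) (hM j) (hM k)
  have zero := hasDerivAt_const (0 : ℝ) (0 : ℝ)
  have e1 := derivative_eq_of_eventuallyEq (cn 0) zero (hE.mono fun t h => h.tangent0)
  have e2 := derivative_eq_of_eventuallyEq (cn 1) zero (hE.mono fun t h => h.tangent1)
  have e3 := derivative_eq_of_eventuallyEq (hs 0 0) (cn 2) (hE.mono fun t h => h.hess00)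
  have e4 := derivative_eq_of_eventuallyEq (hs 0 1) zero (hE.mono fun t h => h.hess01)
  have e5 := derivative_eq_of_eventuallyEq (hs 1 1) (cn 2) (hE.mono fun t h => h.hess11)
  have e6 := derivative_eq_of_eventuallyEq ((cb 0 0 0).add ((hs 0 2).const_mul 3)) (cn 2)
    (hE.mono fun t h => h.cub000)
  have e7 := derivative_eq_of_eventuallyEq ((cb 0 0 1).add (hs 1 2)) zero
    (hE.mono fun t h => h.cub001)
  have e8 := derivative_eq_of_eventuallyEq ((cb 0 1 1).add (hs 0 2)) (cn 2).neg
    (hE.mono fun t h => h.cub011)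
  have e9 := derivative_eq_of_eventuallyEq ((cb 1 1 1).add ((hs 1 2).const_mul 3)) zero
    (hE.mono fun t h => h.cub111)
  clear cn hs cb zero hE hA hM
  simp only [conormal, hess, cub, hM0] at e1 e2 e3 e4 e5 e6 e7 e8 e9
  simp only [hA0 1 0 (by norm_num), hA0 0 1 (by norm_num), hA0 2 0 (by norm_num),
    hA0 1 1 (by norm_num), hA0 0 2 (by norm_num), hA0 3 0 (by norm_num), hA0 2 1 (by norm_num),
    hA0 1 2 (by norm_num), hA0 0 3 (by norm_num), hA' 1 0 (by norm_num), hA' 0 1 (by norm_num),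
    hA' 2 0 (by norm_num), hA' 1 1 (by norm_num), hA' 0 2 (by norm_num), hA' 3 0 (by norm_num),
    hA' 2 1 (by norm_num), hA' 1 2 (by norm_num), hA' 0 3 (by norm_num), stdJet]
    at e1 e2 e3 e4 e5 e6 e7 e8 e9
  have f20 : (2 : Fin 3) ≠ 0 := by decide
  have f21 : (2 : Fin 3) ≠ 1 := by decide
  norm_num [f20, f21] at e1 e2 e3 e4 e5 e6 e7 e8 e9
  ext j i
  fin_cases j <;> fin_cases i <;> simp only [conn, Fin.zero_eta, Fin.mk_one, Fin.reduceFinMk,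
    Matrix.cons_val] <;> linarith

theorem hasDerivAt_line {F : Type*} [NormedAddCommGroup F] [NormedSpace ℝ F] {g : Plane → F}
    {u : Plane} (hg : DifferentiableAt ℝ g u) (v : Plane) :
    HasDerivAt (fun t : ℝ => g (u + t • v)) (fderiv ℝ g u v) 0 := by
  have h1 : HasDerivAt (fun t : ℝ => u + t • v) v 0 := by
    simpa using ((hasDerivAt_id (0 : ℝ)).smul_const v).const_add u
  have h2 : HasFDerivAt g (fderiv ℝ g u) (u + (0 : ℝ) • v) := by
    rw [zero_smul, add_zero]; exact hg.hasFDerivAt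
  exact h2.comp_hasDerivAt 0 h1

/-! ### The structure equations. -/

section Structure

variable {S N : Set A3} {e : A3 → Fin 3 → A3} {I : A3 → Curvatures} {U : Set Plane}
  {X : Plane → A3} {u : Plane}

theorem contDiffAt_frame (h : IsMovingFrame S N e I) (hX : IsPatch (S ∩ N) U X) (hu : u ∈ U) :
    ContDiffAt ℝ ∞ (fun s => e (X s)) u :=
  (h.smooth.comp hX.smooth hX.mapsTo).contDiffAt (hX.isOpen.mem_nhds hu)

theorem IsPatch.contDiffAt (hX : IsPatch S U X) (hu : u ∈ U) : ContDiffAt ℝ ∞ X u :=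
  hX.smooth.contDiffAt (hX.isOpen.mem_nhds hu)

/-- The structure equations of a moving frame. -/
theorem structure_equations (h : IsMovingFrame S N e I) (hX : IsPatch (S ∩ N) U X) (hu : u ∈ U)
    (v : Plane) :
    fderiv ℝ X u v = coframe e X 0 u v • e (X u) 0 + coframe e X 1 u v • e (X u) 1 ∧
    ∀ j, fderiv ℝ (fun s => e (X s) j) u v =
      ∑ i, conn (I (X u)) (coframe e X 0 u v) (coframe e X 1 u v) j i • e (X u) i := by
  obtain ⟨f, ⟨he, ε, hε, hf, hg⟩, ho⟩ := h.adapted _ (hX.mapsTo hu)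
  have hf0 : ContDiffAt ℝ ∞ f 0 := hf.contDiffAt (Metric.ball_mem_nhds _ hε)
  have hJ := jet_of_curvatures hf0 ho
  set E := e (X u) with hE
  let γ : ℝ → Plane := fun t => u + t • v
  have hγc : Continuous γ := by fun_prop
  have hγ0 : γ 0 = u := by simp [γ]
  have hXd : DifferentiableAt ℝ X u := (hX.contDiffAt hu).differentiableAt (by simp)
  have hed : ∀ j, DifferentiableAt ℝ (fun s => e (X s) j) u := fun j =>
    (contDiffAt_pi.1 (contDiffAt_frame h hX hu) j).differentiableAt (by simp)
  -- The moving point and the moving frame are written in the fixed frame `E` at `X u`, in which `S`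
  -- is the graph of `f`.
  let x : ℝ → A3 := fun t i => coordForm E i (X (γ t) - X u)
  let M : ℝ → Fin 3 → A3 := fun t j i => coordForm E i (e (X (γ t)) j)
  have hx' : ∀ i, HasDerivAt (fun t => x t i) (coframe e X i u v) 0 := fun i =>
    (coordForm E i).hasFDerivAt.comp_hasDerivAt 0 ((hasDerivAt_line hXd v).sub_const (X u))
  have hM' : ∀ j i, HasDerivAt (fun t => M t j i)
      (coordForm E i (fderiv ℝ (fun s => e (X s) j) u v)) 0 := fun j i =>
    (coordForm E i).hasFDerivAt.comp_hasDerivAt 0 (hasDerivAt_line (hed j) v)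
  have hx0 : x 0 = 0 := by ext i; simp [x, hγ0]
  have hM0 : ∀ j i, M 0 j i = if j = i then 1 else 0 := by
    intro j i
    simp only [M, hγ0]
    exact coordForm_self he i j
  have hxt : Tendsto x (𝓝 0) (𝓝 0) := by
    have : ContinuousAt x 0 := continuousAt_pi.2 fun i => (hx' i).continuousAt
    have h2 := this.tendsto
    rwa [hx0] at h2
  have hsmall : ∀ᶠ t in 𝓝 (0 : ℝ), ‖x t‖ < ε := by
    have := hxt.norm
    rw [norm_zero] at this
    exact this.eventually_lt_const hε
  have hUt : ∀ᶠ t in 𝓝 (0 : ℝ), γ t ∈ U :=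
    hγc.continuousAt.eventually_mem (by rw [hγ0]; exact hX.isOpen.mem_nhds hu)
  have hsum : ∀ t, X u + ∑ i, x t i • E i = X (γ t) := fun t => sum_coordForm_sub he _ _
  have hcomb : ∀ t, comb E (M t) = e (X (γ t)) := by
    intro t
    ext1 j
    exact sum_coordForm he _
  have hmem : ∀ᶠ t in 𝓝 (0 : ℝ), x t 2 = f (x t 0, x t 1) := by
    filter_upwards [hsmall, hUt] with t h1 h2
    refine (hg _ h1).1 ?_
    rw [hsum]
    exact (hX.mapsTo h2).1
  let π : ℝ → Plane := fun t => (x t 0, x t 1)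
  have hπ' : HasDerivAt π (coframe e X 0 u v, coframe e X 1 u v) 0 := (hx' 0).prodMk (hx' 1)
  have hπ0 : π 0 = 0 := by simp [π, hx0]
  have hjet : ∀ k l, HasDerivAt (fun t => jet f (π t) k l)
      (jet f 0 (k + 1) l * coframe e X 0 u v + jet f 0 k (l + 1) * coframe e X 1 u v) 0 := by
    intro k l
    have hd : DifferentiableAt ℝ (fun s => jet f s k l) (π 0) := by
      rw [hπ0]; exact (contDiffAt_jet hf0 k l).differentiableAt (by simp)
    refine (hd.hasFDerivAt.comp_hasDerivAt 0 hπ').congr_deriv ?_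
    rw [fderiv_eq_pd, pd1_jet, hπ0, pd2_jet hf0]
    ring
  -- The third coordinate is `f` of the first two, and `f` has zero gradient at the origin.
  have hw2 : coframe e X 2 u v = 0 := by
    have := derivative_eq_of_eventuallyEq (hx' 2) (hjet 0 0) hmem
    rw [this, hJ _ _ (by norm_num), hJ _ _ (by norm_num)]
    simp [stdJet]
  have hEq : ∀ᶠ t in 𝓝 (0 : ℝ), FrameEqs (jet f (π t)) (M t) := by
    filter_upwards [hsmall, hUt] with t h1 h2
    have h3 := hX.mapsTo h2
    refine (frameEqs_comb hf hg h1 ?_ ?_).1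
    · rw [hsum]; exact h3.1
    · rw [hsum, hcomb]
      exact (h.adapted _ h3).isAdaptedFrame
  have hder := derivative_of_frameEqs (I := I (X u)) hjet hM'
    (fun k l hkl => by rw [hπ0]; exact hJ k l (by omega))
    (fun k l hkl => by rw [hJ _ _ (by omega), hJ _ _ (by omega)]) hM0 hEq
  refine ⟨?_, fun j => ?_⟩
  · have h1 := sum_coordForm he (fderiv ℝ X u v)
    have h2 : coordForm E 2 (fderiv ℝ X u v) = 0 := hw2
    rw [Fin.sum_univ_three, h2, zero_smul, add_zero] at h1
    exact h1.symm
  · rw [← hder]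
    exact (sum_coordForm he _).symm

end Structure

/-! ### The coframe and its exterior derivative. -/

theorem extDeriv_oneForm {w : Plane → Plane →L[ℝ] ℝ} {u : Plane} (hw : DifferentiableAt ℝ w u)
    (a b : Plane) : extDeriv (oneForm w) u ![a, b] = fderiv ℝ w u a b - fderiv ℝ w u b a := by
  have hd : DifferentiableAt ℝ (oneForm w) u :=
    (ContinuousAlternatingMap.ofSubsingletonLIE (𝕜 := ℝ) (E := Plane) (F := ℝ)
      (0 : Fin 1)).toContinuousLinearEquiv.differentiableAt.comp u hw
  have h1 : ∀ (c : Plane) (m : Fin 1 → Plane),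
      fderiv ℝ (fun s => oneForm w s m) u c = fderiv ℝ w u c (m 0) := by
    intro c m
    have : HasFDerivAt (fun s => w s (m 0))
        ((ContinuousLinearMap.apply ℝ ℝ (m 0)).comp (fderiv ℝ w u)) u :=
      (ContinuousLinearMap.apply ℝ ℝ (m 0)).hasFDerivAt.comp u hw.hasFDerivAt
    exact DFunLike.congr_fun this.fderiv c
  rw [extDeriv_apply hd, Fin.sum_univ_two, h1, h1]
  simp [Fin.removeNth, sub_eq_add_neg]

section

variable {S N : Set A3} {e : A3 → Fin 3 → A3} {I : A3 → Curvatures} {U : Set Plane}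
  {X : Plane → A3} {u : Plane}

theorem coframe_injective (h : IsMovingFrame S N e I) (hX : IsPatch (S ∩ N) U X) (hu : u ∈ U)
    {v : Plane} (h0 : coframe e X 0 u v = 0) (h1 : coframe e X 1 u v = 0) : v = 0 := by
  apply hX.immersion u hu
  rw [(structure_equations h hX hu v).1, h0, h1]
  simp

theorem coframe_surjective (h : IsMovingFrame S N e I) (hX : IsPatch (S ∩ N) U X) (hu : u ∈ U)
    (a b : ℝ) : ∃ v, coframe e X 0 u v = a ∧ coframe e X 1 u v = b := by
  let L : Plane →ₗ[ℝ] Plane :=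
    ((coframe e X 0 u).prod (coframe e X 1 u)).toLinearMap
  have hL : Function.Injective L := by
    refine (injective_iff_map_eq_zero L).2 fun v hv => ?_
    exact coframe_injective h hX hu (congrArg Prod.fst hv) (congrArg Prod.snd hv)
  obtain ⟨v, hv⟩ := LinearMap.injective_iff_surjective.1 hL (a, b)
  exact ⟨v, congrArg Prod.fst hv, congrArg Prod.snd hv⟩

theorem coframe_linearIndependent (h : IsMovingFrame S N e I) (hX : IsPatch (S ∩ N) U X)
    (hu : u ∈ U) : LinearIndependent ℝ ![coframe e X 0 u, coframe e X 1 u] := by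
  rw [LinearIndependent.pair_iff]
  intro s t hst
  obtain ⟨v, h0, h1⟩ := coframe_surjective h hX hu 1 0
  obtain ⟨w, k0, k1⟩ := coframe_surjective h hX hu 0 1
  have hv := DFunLike.congr_fun hst v
  have hw := DFunLike.congr_fun hst w
  simp only [add_apply, smul_apply, h0, h1, k0, k1] at hv hw
  constructor
  · simpa using hv
  · simpa using hw

theorem extDerivEq_unique (h : IsMovingFrame S N e I) (hX : IsPatch (S ∩ N) U X)
    (hu : u ∈ U) {w : Plane → Plane →L[ℝ] ℝ} {Y Y' : ℝ}
    (hY : ExtDerivEq w (coframe e X 0) (coframe e X 1) u Y)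
    (hY' : ExtDerivEq w (coframe e X 0) (coframe e X 1) u Y') : Y = Y' := by
  obtain ⟨v, h0, h1⟩ := coframe_surjective h hX hu 1 0
  obtain ⟨w, k0, k1⟩ := coframe_surjective h hX hu 0 1
  have := (hY v w).symm.trans (hY' v w)
  simpa [h0, h1, k0, k1] using this

theorem contDiffAt_coframe (h : IsMovingFrame S N e I) (hX : IsPatch (S ∩ N) U X) (hu : u ∈ U)
    (i : Fin 3) : ContDiffAt ℝ ∞ (coframe e X i) u := by
  have he := (h.adapted _ (hX.mapsTo hu)).isAdaptedFrame.linearIndependent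
  exact (contDiffAt_coordForm (contDiffAt_frame h hX hu) he i).clm_comp
    ((hX.contDiffAt hu).fderiv_right (by simp))

/-- This is d(dr) = 0: differentiating dX = w₁ e₁ + w₂ e₂ and inserting the structure equations, the
symmetry of the second derivative of `X` gives one identity for each of the components along e₁ and
e₂. -/
theorem extDerivEq_coframe (h : IsMovingFrame S N e I) (hX : IsPatch (S ∩ N) U X) (hu : u ∈ U) :
    ExtDerivEq (coframe e X 0) (coframe e X 0) (coframe e X 1) u (2 * (I (X u)).i13 / 3) ∧
    ExtDerivEq (coframe e X 1) (coframe e X 0) (coframe e X 1) u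
      ((I (X u)).i40 / 4 - (I (X u)).i22 / 2 - (I (X u)).i04 / 12) := by
  have he := (h.adapted _ (hX.mapsTo hu)).isAdaptedFrame.linearIndependent
  have hw : ∀ i, DifferentiableAt ℝ (coframe e X i) u := fun i =>
    (contDiffAt_coframe h hX hu i).differentiableAt (by simp)
  have hed : ∀ j, DifferentiableAt ℝ (fun s => e (X s) j) u := fun j =>
    (contDiffAt_pi.1 (contDiffAt_frame h hX hu) j).differentiableAt (by simp)
  have hXd : DifferentiableAt ℝ (fderiv ℝ X) u :=
    ((hX.contDiffAt hu).fderiv_right (m := 1) (by exact WithTop.coe_le_coe.2 le_top)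
      ).differentiableAt (by norm_num)
  have hsym : IsSymmSndFDerivAt ℝ X u :=
    (hX.contDiffAt hu).isSymmSndFDerivAt (by
      rw [minSmoothness_of_isRCLikeNormedField]
      exact WithTop.coe_le_coe.2 le_top)
  have hsnd : ∀ a b : Plane, fderiv ℝ (fderiv ℝ X) u a b
      = (fderiv ℝ (coframe e X 0) u a b • e (X u) 0
          + coframe e X 0 u b • fderiv ℝ (fun s => e (X s) 0) u a)
        + (fderiv ℝ (coframe e X 1) u a b • e (X u) 1
          + coframe e X 1 u b • fderiv ℝ (fun s => e (X s) 1) u a) := by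
    intro a b
    have h1 : HasFDerivAt (fun s => fderiv ℝ X s b)
        ((ContinuousLinearMap.apply ℝ A3 b).comp (fderiv ℝ (fderiv ℝ X) u)) u :=
      (ContinuousLinearMap.apply ℝ A3 b).hasFDerivAt.comp u hXd.hasFDerivAt
    have hwb : ∀ i, HasFDerivAt (fun s => coframe e X i s b)
        ((ContinuousLinearMap.apply ℝ ℝ b).comp (fderiv ℝ (coframe e X i) u)) u := fun i =>
      (ContinuousLinearMap.apply ℝ ℝ b).hasFDerivAt.comp u (hw i).hasFDerivAt
    have h2 := ((hwb 0).smul (hed 0).hasFDerivAt).add ((hwb 1).smul (hed 1).hasFDerivAt)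
    have h3 : (fun s => fderiv ℝ X s b) =ᶠ[𝓝 u] fun s =>
        coframe e X 0 s b • e (X s) 0 + coframe e X 1 s b • e (X s) 1 := by
      filter_upwards [hX.isOpen.mem_nhds hu] with s hs
      exact (structure_equations h hX hs b).1
    have h4 := DFunLike.congr_fun (h1.unique (h2.congr_of_eventuallyEq h3)) a
    refine h4.trans ?_
    simp only [add_apply, smul_apply, ContinuousLinearMap.smulRight_apply,
      ContinuousLinearMap.comp_apply, ContinuousLinearMap.apply_apply]
    abel
  have key : ∀ (i : Fin 3) (a b : Plane),
      coordForm (e (X u)) i (fderiv ℝ (fderiv ℝ X) u a b)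
      = (fderiv ℝ (coframe e X 0) u a b * (if (0 : Fin 3) = i then 1 else 0) + coframe e X 0 u b *
          conn (I (X u)) (coframe e X 0 u a) (coframe e X 1 u a) 0 i)
      + (fderiv ℝ (coframe e X 1) u a b * (if (1 : Fin 3) = i then 1 else 0) + coframe e X 1 u b *
          conn (I (X u)) (coframe e X 0 u a) (coframe e X 1 u a) 1 i) := by
    intro i a b
    rw [hsnd, (structure_equations h hX hu a).2 0, (structure_equations h hX hu a).2 1]
    simp only [map_add, map_smul, coordForm_sum he, coordForm_self he, smul_eq_mul]
  constructor
  · intro a b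
    rw [extDeriv_oneForm (hw 0)]
    have k1 := key 0 a b
    rw [hsym a b, key 0 b a] at k1
    simp only [conn, Matrix.cons_val, if_true, one_ne_zero, if_false] at k1
    linear_combination -k1
  · intro a b
    rw [extDeriv_oneForm (hw 1)]
    have k1 := key 1 a b
    rw [hsym a b, key 1 b a] at k1
    simp only [conn, Matrix.cons_val, if_true, zero_ne_one, if_false] at k1
    linear_combination -k1

theorem curvatures_eq (h : IsMovingFrame S N e I) (hX : IsPatch (S ∩ N) U X) (hu : u ∈ U)
    {Y₁ Y₂ : ℝ} (h1 : ExtDerivEq (coframe e X 0) (coframe e X 0) (coframe e X 1) u Y₁)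
    (h2 : ExtDerivEq (coframe e X 1) (coframe e X 0) (coframe e X 1) u Y₂) :
    (I (X u)).i13 = 3 / 2 * Y₁ ∧
      (I (X u)).i04 = 3 * (I (X u)).i40 - 6 * (I (X u)).i22 - 12 * Y₂ := by
  have k1 := extDerivEq_unique h hX hu h1 (extDerivEq_coframe h hX hu).1
  have k2 := extDerivEq_unique h hX hu h2 (extDerivEq_coframe h hX hu).2
  constructor <;> linarith

end

/-! ### From equal invariants to an affine transformation. -/

/-- A surface with a moving frame has a parametrization near each point. -/
theorem IsMovingFrame.exists_patch {S N : Set A3} {e : A3 → Fin 3 → A3} {I : A3 → Curvatures}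
    (h : IsMovingFrame S N e I) {p : A3} (hp : p ∈ S ∩ N) :
    ∃ (δ : ℝ) (X : Plane → A3), 0 < δ ∧ IsPatch (S ∩ N) (Metric.ball 0 δ) X ∧
      ∀ᶠ q in 𝓝[S] p, q ∈ X '' Metric.ball 0 δ := by
  obtain ⟨f, ⟨he, ε, hε, hf, hg⟩, ho⟩ := h.adapted p hp
  set E := e p
  have hf0 : ContDiffAt ℝ ∞ f 0 := hf.contDiffAt (Metric.ball_mem_nhds _ hε)
  have f00 : f 0 = 0 := jet_of_curvatures hf0 ho 0 0 (by norm_num)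
  let ξ : Plane → A3 := fun s => ![s.1, s.2, f s]
  let X : Plane → A3 := fun s => p + ∑ i, ξ s i • E i
  have hξ : ContDiffOn ℝ ∞ ξ (Metric.ball 0 ε) := by
    refine contDiffOn_pi.2 fun i => ?_
    fin_cases i
    · exact contDiff_fst.contDiffOn
    · exact contDiff_snd.contDiffOn
    · exact hf
  have hX : ContDiffOn ℝ ∞ X (Metric.ball 0 ε) :=
    contDiffOn_const.add (ContDiffOn.sum fun i _ =>
      (contDiffOn_pi.1 hξ i).smul contDiffOn_const)
  have hξ0 : ξ 0 = 0 := by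
    ext i; fin_cases i <;> simp [ξ, f00]
  have hX0 : X 0 = p := by simp [X, hξ0]
  have hξc : ContinuousAt ξ 0 := (hξ.contDiffAt (Metric.ball_mem_nhds _ hε)).continuousAt
  have hXc : ContinuousAt X 0 := (hX.contDiffAt (Metric.ball_mem_nhds _ hε)).continuousAt
  have ev : ∀ᶠ s in 𝓝 (0 : Plane), s ∈ Metric.ball (0 : Plane) ε ∧
      ξ s ∈ Metric.ball (0 : A3) ε ∧ X s ∈ N :=
    (Metric.isOpen_ball.eventually_mem (Metric.mem_ball_self hε)).and
      ((hξc.eventually_mem (by rw [hξ0]; exact Metric.ball_mem_nhds _ hε)).and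
      (hXc.eventually_mem (by rw [hX0]; exact h.isOpen.mem_nhds hp.2)))
  obtain ⟨δ, hδ, H⟩ := Metric.eventually_nhds_iff_ball.1 ev
  have hXS : ∀ s ∈ Metric.ball (0 : Plane) δ, X s ∈ S := fun s hs =>
    (hg (ξ s) (by simpa using (H s hs).2.1)).2 rfl
  -- The first two coordinates in `E` recover the parameter, so `X` has a smooth left inverse and is
  -- an immersion.
  have hcoord : ∀ s i, coordForm E i (X s - p) = ξ s i := by
    intro s i
    simp only [X, add_sub_cancel_left]
    exact coordForm_sum he _ i
  refine ⟨δ, X, hδ, ⟨Metric.isOpen_ball, hX.mono fun s hs => (H s hs).1,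
    fun s hs => ⟨hXS s hs, (H s hs).2.2⟩, ?_⟩, ?_⟩
  · intro u hu
    have hd : DifferentiableAt ℝ X u :=
      (hX.contDiffAt (Metric.isOpen_ball.mem_nhds (H u hu).1)).differentiableAt (by simp)
    refine (injective_iff_map_eq_zero _).2 fun v hv => ?_
    have key : ∀ i, HasFDerivAt (fun s => ξ s i) ((coordForm E i).comp (fderiv ℝ X u)) u := by
      intro i
      have := (coordForm E i).hasFDerivAt.comp u (hd.hasFDerivAt.sub_const p)
      exact this.congr_of_eventuallyEq (Eventually.of_forall fun s => (hcoord s i).symm)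
    have k0 := DFunLike.congr_fun ((key 0).unique hasFDerivAt_fst) v
    have k1 := DFunLike.congr_fun ((key 1).unique hasFDerivAt_snd) v
    simp only [ContinuousLinearMap.comp_apply, hv, map_zero] at k0 k1
    exact Prod.ext k0.symm k1.symm
  · let x : A3 → A3 := fun q i => coordForm E i (q - p)
    have hxc : Continuous x := continuous_pi fun i => by fun_prop
    have hx0 : x p = 0 := by ext i; simp [x]
    have hsmall : ∀ᶠ q in 𝓝[S] p, x q ∈ Metric.ball (0 : A3) (min δ ε) :=
      nhdsWithin_le_nhds (hxc.continuousAt.eventually_mem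
        (by rw [hx0]; exact Metric.ball_mem_nhds _ (lt_min hδ hε)))
    filter_upwards [hsmall, self_mem_nhdsWithin] with q hq hqS
    rw [mem_ball_zero_iff, lt_min_iff] at hq
    have hsum : p + ∑ i, x q i • E i = q := sum_coordForm_sub he p q
    have h2 := (hg (x q) hq.2).1 (by rw [hsum]; exact hqS)
    refine ⟨(x q 0, x q 1), ?_, ?_⟩
    · rw [mem_ball_zero_iff]
      exact lt_of_le_of_lt (max_le (norm_le_pi_norm (x q) 0) (norm_le_pi_norm (x q) 1)) hq.1
    · have : ξ (x q 0, x q 1) = x q := by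
        ext i; fin_cases i <;> simp [ξ, h2]
      simp only [X, this, hsum]

/-- An affine transformation is determined by its values on a piece of an elliptical surface. -/
theorem affineEquiv_eq_of_eventually {S : Set A3} {p : A3} {e : Fin 3 → A3} (hp : p ∈ S)
    (h : IsAdaptedFrame S p e) {T T' : A3 ≃ᵃ[ℝ] A3} (hT : ∀ᶠ q in 𝓝[S] p, T q = T' q) :
    T = T' := by
  obtain ⟨f, ⟨he, ε, hε, hf, hg⟩, ho⟩ := h
  have hf0 : ContDiffAt ℝ ∞ f 0 := hf.contDiffAt (Metric.ball_mem_nhds _ hε)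
  have f00 : f 0 = 0 := jet_of_adapted hf0 ho ⟨0, 0, 0, 0, 0⟩ 0 0 (by norm_num)
  have hTp : T p = T' p := hT.self_of_nhdsWithin hp
  let D : A3 →ₗ[ℝ] A3 := T.linear.toLinearMap - T'.linear.toLinearMap
  have hD : ∀ q, T q = T' q → D (q - p) = 0 := by
    intro q hq
    have h1 := T.map_vadd p (q - p)
    have h2 := T'.map_vadd p (q - p)
    simp only [vadd_eq_add, sub_add_cancel] at h1 h2
    rw [h1, h2, hTp] at hq
    simp only [D, LinearMap.sub_apply, LinearEquiv.coe_coe]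
    exact sub_eq_zero.2 (add_right_cancel hq)
  let ξ : Plane → A3 := fun s => ![s.1, s.2, f s]
  have hξc : ContinuousAt ξ 0 := by
    refine continuousAt_pi.2 fun i => ?_
    fin_cases i
    · exact continuousAt_fst
    · exact continuousAt_snd
    · exact hf0.continuousAt
  have hξ0 : ξ 0 = 0 := by
    ext i; fin_cases i <;> simp [ξ, f00]
  have hξt : ∀ᶠ s in 𝓝 (0 : Plane), ξ s ∈ Metric.ball (0 : A3) ε :=
    hξc.eventually_mem (by rw [hξ0]; exact Metric.ball_mem_nhds _ hε)
  have hlim : Tendsto (fun s => p + ∑ i, ξ s i • e i) (𝓝 0) (𝓝[S] p) := by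
    refine tendsto_nhdsWithin_iff.2 ⟨?_, ?_⟩
    · have : ContinuousAt (fun s => p + ∑ i, ξ s i • e i) 0 := by
        have hi := fun i => continuousAt_pi.1 hξc i
        fun_prop
      simpa [ContinuousAt, hξ0] using this
    · filter_upwards [hξt] with s hs
      exact (hg (ξ s) (by simpa using hs)).2 rfl
  -- The difference `D` of the linear parts vanishes on all differences of nearby surface points and
  -- `p`.
  have hzero : ∀ᶠ s in 𝓝 (0 : Plane), s.1 • D (e 0) + s.2 • D (e 1) + f s • D (e 2) = 0 := by
    filter_upwards [hlim.eventually hT] with s hs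
    have := hD _ hs
    simpa [Fin.sum_univ_three, ξ] using this
  have hk : ∀ i k, D (e i) k = 0 := by
    intro i k
    -- The 3-jet of `hzero` with `f` replaced by the standard cubic. Its first-order coefficients
    -- are `D (e 0)` and `D (e 1)`; `D (e 2)` shows up in the coefficient of x², which is present
    -- because the surface is curved.
    let J : ℕ → ℕ → ℝ := fun a b => (if a = 1 ∧ b = 0 then D (e 0) k else 0)
      + (if a = 0 ∧ b = 1 then D (e 1) k else 0) + D (e 2) k * stdJet ⟨0, 0, 0, 0, 0⟩ a b
    have hJ : taylorPoly 3 J =o[𝓝 0] fun s : Plane => ‖s‖ ^ 3 := by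
      refine (ho.const_mul_left (-D (e 2) k)).congr' ?_ EventuallyEq.rfl
      filter_upwards [hzero] with s hs
      have h1 := congrFun hs k
      simp only [Pi.add_apply, Pi.smul_apply, smul_eq_mul, Pi.zero_apply] at h1
      rw [taylorPoly_three]
      simp [J, stdJet, standardCubic]
      linear_combination -h1
    have c0 := taylorPoly_coeff_eq_zero 3 hJ 1 0 (by norm_num)
    have c1 := taylorPoly_coeff_eq_zero 3 hJ 0 1 (by norm_num)
    have c2 := taylorPoly_coeff_eq_zero 3 hJ 2 0 (by norm_num)
    simp only [J, stdJet] at c0 c1 c2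
    norm_num at c0 c1 c2
    fin_cases i
    · exact c0
    · exact c1
    · exact c2
  ext1 q
  have h1 := T.map_vadd p (q - p)
  have h2 := T'.map_vadd p (q - p)
  simp only [vadd_eq_add, sub_add_cancel] at h1 h2
  have h3 : D (q - p) = 0 := by
    rw [← sum_coordForm he (q - p), map_sum]
    refine Finset.sum_eq_zero fun i _ => ?_
    rw [map_smul, show D (e i) = 0 from funext (hk i), smul_zero]
  have h4 : T.linear (q - p) = T'.linear (q - p) := sub_eq_zero.1 h3
  rw [h1, h2, h4, hTp]

theorem ExtDerivEq.congr {w w' a a' b b' : Plane → Plane →L[ℝ] ℝ} {u : Plane} {Y : ℝ}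
    (h : ExtDerivEq w a b u Y) (hw : w =ᶠ[𝓝 u] w') (ha : a u = a' u) (hb : b u = b' u) :
    ExtDerivEq w' a' b' u Y := by
  intro v v'
  have : oneForm w =ᶠ[𝓝 u] oneForm w' := by
    filter_upwards [hw] with s hs
    simp only [oneForm, hs]
  rw [← this.extDeriv_eq, h v v', ha, hb]

/-- Two parametrized surfaces with moving frames with equal coframes and curvatures are related by
an affine transformation. -/
theorem exists_affineEquiv_of_coframe_eq {S S' N N' : Set A3} {e e' : A3 → Fin 3 → A3}
    {I I' : A3 → Curvatures} (h : IsMovingFrame S N e I) (h' : IsMovingFrame S' N' e' I')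
    {δ : ℝ} (hδ : 0 < δ) {X X' : Plane → A3} (hX : IsPatch (S ∩ N) (Metric.ball 0 δ) X)
    (hX' : IsPatch (S' ∩ N') (Metric.ball 0 δ) X')
    (h0 : ∀ u ∈ Metric.ball (0 : Plane) δ, coframe e' X' 0 u = coframe e X 0 u)
    (h1 : ∀ u ∈ Metric.ball (0 : Plane) δ, coframe e' X' 1 u = coframe e X 1 u)
    (hI : ∀ u ∈ Metric.ball (0 : Plane) δ, I' (X' u) = I (X u)) :
    ∃ T : A3 ≃ᵃ[ℝ] A3, ∀ u ∈ Metric.ball (0 : Plane) δ, X' u = T (X u) := by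
  have he : ∀ u ∈ Metric.ball (0 : Plane) δ, LinearIndependent ℝ (e (X u)) := fun u hu =>
    (h.adapted _ (hX.mapsTo hu)).isAdaptedFrame.linearIndependent
  have he' : ∀ u ∈ Metric.ball (0 : Plane) δ, LinearIndependent ℝ (e' (X' u)) := fun u hu =>
    (h'.adapted _ (hX'.mapsTo hu)).isAdaptedFrame.linearIndependent
  have hed : ∀ u ∈ Metric.ball (0 : Plane) δ, ∀ j, DifferentiableAt ℝ (fun s => e (X s) j) u :=
    fun u hu j => (contDiffAt_pi.1 (contDiffAt_frame h hX hu) j).differentiableAt (by simp)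
  have hed' : ∀ u ∈ Metric.ball (0 : Plane) δ, ∀ j,
      DifferentiableAt ℝ (fun s => e' (X' s) j) u :=
    fun u hu j => (contDiffAt_pi.1 (contDiffAt_frame h' hX' hu) j).differentiableAt (by simp)
  -- The linear map carrying the frame of the first surface to the frame of the second.
  let L : Plane → A3 →L[ℝ] A3 := fun u =>
    ∑ j, (coordForm (e (X u)) j).smulRight (e' (X' u) j)
  have hLe : ∀ u ∈ Metric.ball (0 : Plane) δ, ∀ j, L u (e (X u) j) = e' (X' u) j := by
    intro u hu j
    simp [L, _root_.sum_apply, coordForm_self (he u hu)]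
  have hLd : ∀ u ∈ Metric.ball (0 : Plane) δ, DifferentiableAt ℝ L u := by
    intro u hu
    refine DifferentiableAt.fun_sum fun j _ => ?_
    exact ((contDiffAt_coordForm (contDiffAt_frame h hX hu) (he u hu) j).smulRight
      (contDiffAt_pi.1 (contDiffAt_frame h' hX' hu) j)).differentiableAt (by simp)
  -- Both frames have the same connection matrix `conn`, so differentiating `L (e j) = e' j` leaves
  -- (dL)(e j) = 0.
  have hL0 : ∀ u ∈ Metric.ball (0 : Plane) δ, fderiv ℝ L u = 0 := by
    intro u hu
    refine ContinuousLinearMap.ext fun v => ?_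
    have hj : ∀ j, fderiv ℝ L u v (e (X u) j) = 0 := by
      intro j
      have k1 := (hLd u hu).hasFDerivAt.clm_apply (hed u hu j).hasFDerivAt
      have k2 : (fun s => L s (e (X s) j)) =ᶠ[𝓝 u] fun s => e' (X' s) j := by
        filter_upwards [Metric.isOpen_ball.mem_nhds hu] with s hs using hLe s hs j
      have k3 := DFunLike.congr_fun
        (k1.unique ((hed' u hu j).hasFDerivAt.congr_of_eventuallyEq k2)) v
      rw [(structure_equations h' hX' hu v).2 j, h0 u hu, h1 u hu, hI u hu] at k3
      simp only [add_apply, ContinuousLinearMap.comp_apply, ContinuousLinearMap.flip_apply,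
        (structure_equations h hX hu v).2 j, map_sum, map_smul, hLe u hu] at k3
      simpa using k3
    refine ContinuousLinearMap.ext fun a => ?_
    change fderiv ℝ L u v a = 0
    rw [← sum_coordForm (he u hu) a]
    simp only [map_sum, map_smul, hj, smul_zero, Finset.sum_const_zero]
  have hpre : IsPreconnected (Metric.ball (0 : Plane) δ) := (convex_ball 0 δ).isPreconnected
  have hmem0 : (0 : Plane) ∈ Metric.ball (0 : Plane) δ := Metric.mem_ball_self hδ
  have hLc : ∀ u ∈ Metric.ball (0 : Plane) δ, L u = L 0 := fun u hu =>
    Metric.isOpen_ball.is_const_of_fderiv_eq_zero hpre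
      (fun u hu => (hLd u hu).differentiableWithinAt) hL0 hu hmem0
  have hXd : ∀ u ∈ Metric.ball (0 : Plane) δ, DifferentiableAt ℝ X u := fun u hu =>
    (hX.contDiffAt hu).differentiableAt (by simp)
  have hXd' : ∀ u ∈ Metric.ball (0 : Plane) δ, DifferentiableAt ℝ X' u := fun u hu =>
    (hX'.contDiffAt hu).differentiableAt (by simp)
  -- With `L` constant and equal coframes, dX' = L dX, so `X'` and `L ∘ X` differ by a translation.
  have hdiff : ∀ u ∈ Metric.ball (0 : Plane) δ,
      HasFDerivAt (fun s => X' s - L 0 (X s)) (0 : Plane →L[ℝ] A3) u := by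
    intro u hu
    refine ((hXd' u hu).hasFDerivAt.sub
      ((L 0).hasFDerivAt.comp u (hXd u hu).hasFDerivAt)).congr_fderiv ?_
    refine ContinuousLinearMap.ext fun v => ?_
    rw [sub_apply, ContinuousLinearMap.comp_apply, ← hLc u hu,
      (structure_equations h hX hu v).1, (structure_equations h' hX' hu v).1, h0 u hu, h1 u hu]
    simp [hLe u hu]
  have hconst : ∀ u ∈ Metric.ball (0 : Plane) δ,
      X' u - L 0 (X u) = X' 0 - L 0 (X 0) := fun u hu =>
    Metric.isOpen_ball.is_const_of_fderiv_eq_zero hpre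
      (fun u hu => (hdiff u hu).differentiableAt.differentiableWithinAt)
      (fun u hu => (hdiff u hu).fderiv) hu hmem0
  have hinj : Function.Injective (L 0).toLinearMap := by
    refine (injective_iff_map_eq_zero _).2 fun v hv => ?_
    have hv' : ∑ j, coordForm (e (X 0)) j v • e' (X' 0) j = 0 := by
      simpa [L, _root_.sum_apply] using hv
    have := Fintype.linearIndependent_iff.1 (he' 0 hmem0) _ hv'
    rw [← sum_coordForm (he 0 hmem0) v]
    simp [this]
  refine ⟨(LinearEquiv.ofInjectiveEndo _ hinj).toAffineEquiv.trans
    (AffineEquiv.constVAdd ℝ A3 (X' 0 - L 0 (X 0))), fun u hu => ?_⟩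
  have := hconst u hu
  rw [sub_eq_iff_eq_add] at this
  simpa using this

theorem PreservesInvariants.eventually_eq_affineEquiv {S S' : Set A3} {φ : A3 → A3}
    (h : PreservesInvariants S S' φ) {p : A3} (hp : p ∈ S) :
    ∃ T : A3 ≃ᵃ[ℝ] A3, ∀ᶠ q in 𝓝[S] p, φ q = T q := by
  obtain ⟨hφ, hmaps, H⟩ := h
  obtain ⟨N, N', e, e', I, I', hpN, hN, he, he', hI, hw⟩ := H p hp
  obtain ⟨δ, X, hδ, hX, hcov⟩ := he.exists_patch ⟨hp, hpN⟩
  have hw0 := fun u hu => (hw _ X hX u hu).1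
  have hw1 := fun u hu => (hw _ X hX u hu).2
  have hX' : IsPatch (S' ∩ N') (Metric.ball 0 δ) (φ ∘ X) := by
    refine ⟨hX.isOpen, hφ.comp hX.smooth fun u hu => (hX.mapsTo hu).1,
      fun u hu => ⟨hmaps (hX.mapsTo hu).1, hN (hX.mapsTo hu)⟩, fun u hu => ?_⟩
    refine (injective_iff_map_eq_zero _).2 fun v hv => ?_
    refine coframe_injective he hX hu ?_ ?_
    · rw [← hw0 u hu, coframe, ContinuousLinearMap.comp_apply, hv, map_zero]
    · rw [← hw1 u hu, coframe, ContinuousLinearMap.comp_apply, hv, map_zero]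
  -- The two curvatures missing from the assumptions, I₁₃ and I₀₄, are determined by dw₁ and dw₂,
  -- which agree because the coframes agree on an open set.
  have hII : ∀ u ∈ Metric.ball (0 : Plane) δ, I' ((φ ∘ X) u) = I (X u) := by
    intro u hu
    have e0 : coframe e' (φ ∘ X) 0 =ᶠ[𝓝 u] coframe e X 0 := by
      filter_upwards [Metric.isOpen_ball.mem_nhds hu] with s hs using hw0 s hs
    have e1 : coframe e' (φ ∘ X) 1 =ᶠ[𝓝 u] coframe e X 1 := by
      filter_upwards [Metric.isOpen_ball.mem_nhds hu] with s hs using hw1 s hs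
    obtain ⟨d0, d1⟩ := extDerivEq_coframe he' hX' hu
    obtain ⟨k1, k2⟩ := curvatures_eq he hX hu (d0.congr e0 (hw0 u hu) (hw1 u hu))
      (d1.congr e1 (hw0 u hu) (hw1 u hu))
    obtain ⟨i1, i2, i3⟩ := hI _ (hX.mapsTo hu)
    simp only [Function.comp_apply] at k1 k2 ⊢
    generalize I' (φ (X u)) = A at *
    generalize I (X u) = B at *
    obtain ⟨a1, a2, a3, a4, a5⟩ := A
    obtain ⟨b1, b2, b3, b4, b5⟩ := B
    simp only [Curvatures.mk.injEq] at *
    exact ⟨i1, i2, i3, by linarith, by linarith⟩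
  obtain ⟨T, hT⟩ := exists_affineEquiv_of_coframe_eq he he' hδ hX hX' hw0 hw1 hII
  refine ⟨T, hcov.mono ?_⟩
  rintro _ ⟨u, hu, rfl⟩
  exact hT u hu

/-- The local affine maps at nearby points agree on a common piece of `S`, hence coincide by
`affineEquiv_eq_of_eventually`. The choice of map is thus locally constant on a connected space. -/
theorem PreservesInvariants.exists_affineEquiv {S S' : Set A3} (hS : IsRegularElliptical S)
    (hc : IsConnected S) {φ : A3 → A3} (h : PreservesInvariants S S' φ) :
    ∃ T : A3 ≃ᵃ[ℝ] A3, EqOn φ T S := by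
  choose T hT using fun p : S => h.eventually_eq_affineEquiv p.2
  have hloc : IsLocallyConstant T := by
    rw [IsLocallyConstant.iff_eventually_eq]
    intro p
    have h1 : ∀ᶠ q in 𝓝[S] (p : A3), ∀ᶠ r in 𝓝[S] q, φ r = T p r :=
      eventually_eventually_nhdsWithin.2 (hT p)
    rw [nhdsWithin_eq_map_subtype_coe p.2, eventually_map] at h1
    filter_upwards [h1] with q hq
    obtain ⟨e, he⟩ := hS q q.2
    refine affineEquiv_eq_of_eventually q.2 he ?_
    filter_upwards [hq, hT q] with r hr1 hr2
    rw [← hr1, ← hr2]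
  have : PreconnectedSpace S := Subtype.preconnectedSpace hc.isPreconnected
  obtain ⟨p, hp⟩ := hc.nonempty
  refine ⟨T ⟨p, hp⟩, fun q hq => ?_⟩
  rw [← hloc.apply_eq_of_preconnectedSpace ⟨q, hq⟩ ⟨p, hp⟩]
  exact (hT ⟨q, hq⟩).self_of_nhdsWithin hq

theorem preservesInvariants_affineEquiv {S : Set A3} (hS : IsRegularElliptical S)
    (T : A3 ≃ᵃ[ℝ] A3) : PreservesInvariants S (T '' S) T := by
  refine ⟨(contDiff_affineEquiv T).contDiffOn, mapsTo_image T S, fun p hp => ?_⟩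
  obtain ⟨N, e, I, hpN, h⟩ := exists_isMovingFrame hS hp
  exact ⟨N, T '' N, e, _, I, _, hpN, fun q hq => mem_image_of_mem T hq.2, h, h.image T,
    fun q _ => by simp, fun U X hX u hu => ⟨coframe_image h T hX hu 0, coframe_image h T hX hu 1⟩⟩

end GenAffine

theorem theorem4p2 (S : Set GenAffine.A3) (hS : GenAffine.IsRegularElliptical S) :
    -- near each point there is a smooth adapted moving frame
    (∀ p ∈ S, ∃ (N : Set GenAffine.A3) (e : GenAffine.A3 → Fin 3 → GenAffine.A3)
      (I : GenAffine.A3 → GenAffine.Curvatures),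
      p ∈ N ∧ GenAffine.IsMovingFrame S N e I) ∧
    -- adapted frames at a point, hence coframe and curvatures, are unique up to the group D₃
    (∀ p ∈ S, ∀ e e' : Fin 3 → GenAffine.A3, GenAffine.IsAdaptedFrame S p e →
      (GenAffine.IsAdaptedFrame S p e' ↔ GenAffine.IsD3Related e e')) ∧
    -- w₁, w₂ is a coframe, and dw₁, dw₂ determine I₁₃ and I₀₄
    (∀ (N : Set GenAffine.A3) (e : GenAffine.A3 → Fin 3 → GenAffine.A3)
      (I : GenAffine.A3 → GenAffine.Curvatures), GenAffine.IsMovingFrame S N e I →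
      ∀ (U : Set GenAffine.Plane) (X : GenAffine.Plane → GenAffine.A3),
        GenAffine.IsPatch (S ∩ N) U X → ∀ u ∈ U,
        (∀ v : GenAffine.Plane, fderiv ℝ X u v =
          GenAffine.coframe e X 0 u v • e (X u) 0 + GenAffine.coframe e X 1 u v • e (X u) 1) ∧
        LinearIndependent ℝ ![GenAffine.coframe e X 0 u, GenAffine.coframe e X 1 u] ∧
        GenAffine.ExtDerivEq (GenAffine.coframe e X 0)
          (GenAffine.coframe e X 0) (GenAffine.coframe e X 1) u (2 * (I (X u)).i13 / 3) ∧
        GenAffine.ExtDerivEq (GenAffine.coframe e X 1)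
          (GenAffine.coframe e X 0) (GenAffine.coframe e X 1) u
          ((I (X u)).i40 / 4 - (I (X u)).i22 / 2 - (I (X u)).i04 / 12) ∧
        ∀ Y₁ Y₂ : ℝ,
          GenAffine.ExtDerivEq (GenAffine.coframe e X 0)
            (GenAffine.coframe e X 0) (GenAffine.coframe e X 1) u Y₁ →
          GenAffine.ExtDerivEq (GenAffine.coframe e X 1)
            (GenAffine.coframe e X 0) (GenAffine.coframe e X 1) u Y₂ →
          (I (X u)).i13 = 3 / 2 * Y₁ ∧
          (I (X u)).i04 = 3 * (I (X u)).i40 - 6 * (I (X u)).i22 - 12 * Y₂) ∧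
    -- invariance under affine transformations
    (∀ T : GenAffine.A3 ≃ᵃ[ℝ] GenAffine.A3,
      GenAffine.IsRegularElliptical (T '' S) ∧
      ∀ (N : Set GenAffine.A3) (e : GenAffine.A3 → Fin 3 → GenAffine.A3)
        (I : GenAffine.A3 → GenAffine.Curvatures), GenAffine.IsMovingFrame S N e I →
        GenAffine.IsMovingFrame (T '' S) (T '' N)
          (fun q i => T.linear (e (T.symm q) i)) (fun q => I (T.symm q)) ∧
        ∀ (U : Set GenAffine.Plane) (X : GenAffine.Plane → GenAffine.A3),
          GenAffine.IsPatch (S ∩ N) U X → ∀ u ∈ U, ∀ i : Fin 3,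
          GenAffine.coframe (fun q j => T.linear (e (T.symm q) j)) (T ∘ X) i u =
            GenAffine.coframe e X i u) ∧
    -- completeness
    (IsConnected S → ∀ S' : Set GenAffine.A3, GenAffine.IsRegularElliptical S' →
      (∀ φ : GenAffine.A3 → GenAffine.A3, GenAffine.PreservesInvariants S S' φ →
        ∃ T : GenAffine.A3 ≃ᵃ[ℝ] GenAffine.A3, Set.EqOn φ T S) ∧
      ((∃ T : GenAffine.A3 ≃ᵃ[ℝ] GenAffine.A3, T '' S = S') ↔
        ∃ φ : GenAffine.A3 → GenAffine.A3,
          Set.BijOn φ S S' ∧ GenAffine.PreservesInvariants S S' φ)) := by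
  open GenAffine in
  refine ⟨fun p hp => exists_isMovingFrame hS hp, fun p hp e e' he => isAdaptedFrame_iff hp he,
    fun N e I h U X hX u hu => ⟨fun v => (structure_equations h hX hu v).1,
      coframe_linearIndependent h hX hu, (extDerivEq_coframe h hX hu).1,
      (extDerivEq_coframe h hX hu).2, fun Y₁ Y₂ h1 h2 => curvatures_eq h hX hu h1 h2⟩,
    fun T => ⟨hS.image T, fun N e I h => ⟨h.image T,
      fun U X hX u hu i => coframe_image h T hX hu i⟩⟩,
    fun hc S' _ => ⟨fun φ hφ => hφ.exists_affineEquiv hS hc, ?_, ?_⟩⟩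
  · rintro ⟨T, rfl⟩
    exact ⟨T, T.injective.injOn.bijOn_image, preservesInvariants_affineEquiv hS T⟩
  · rintro ⟨φ, hb, hφ⟩
    obtain ⟨T, hT⟩ := hφ.exists_affineEquiv hS hc
    exact ⟨T, hT.image_eq.symm.trans hb.image_eq⟩
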